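/- \textbf{Problem.} An instance of 2-valued makespan minimization with assignment constraints, with job sizes $1$ and $1/\alpha$, $\alpha>1$, consists of a finite set $J$ of jobs, a finite set $M$ of machines, for each job $j$ a non-empty set $M_j\subseteq M$, and a size $p_j\in\{1,1/\alpha\}$ (each job is marked as big, $p_j=1$, or small, $p_j=1/\alpha$). A schedule is a map $\sigma:J\to M$ with $\sigma(j)\in M_j$ for all $j$; its makespan is $\max_{i\in M}\sum_{j:\sigma(j)=i}p_j$ (equal to $0$ if $M=\emptyset$), and $\mathrm{Opt}$ is the minimum makespan of a schedule. \textbf{Theorem.} For $\alpha>1$ let $f_1=\lceil\alpha\rceil/\alpha$, $f_2=\lfloor\alpha\rfloor/\alpha$ and $$\rho(\alpha)=\min\Bigl\{1+f_1-\frac1\alpha,\ \frac1{f_2}+1-\frac1{\lfloor\alpha\rfloor}\Bigr\}.$$ For any such instance, a schedule of makespan at most $\rho(\alpha)\cdot\mathrm{Opt}$ can be found in polynomial time. Precisely: (1) there is a single algorithm that, given a rational $\alpha>1$ (numerator and denominator in binary) and any instance with job sizes in $\{1,1/\alpha\}$, outputs such a schedule in time polynomial in the bit length of the input (which includes $\alpha$);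 (2) for every fixed real $\alpha>1$ there is an algorithm that, given any instance with job sizes in $\{1,1/\alpha\}$ (which jobs are big, and the sets $M_j$), outputs such a schedule in time polynomial in the bit length of the instance. Here an algorithm is a program of a deterministic random access machine over the natural numbers (addition, truncated subtraction, multiplication, integer division, indirect addressing, branching and loops) under the logarithmic cost measure; this is polynomially equivalent to Turing machines. -/

import Mathlib

/-! ### Random access machines with logarithmic cost -/

namespace RAM

/-- Structured programs of a random access machine over the natural numbers. Numerals `d a b` name
registers; `load` and `store` address the memory indirectly through a register. -/
inductive Cmd : Type
  /-- `r_d := c` -/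
  | const (d c : ℕ) : Cmd
  /-- `r_d := r_a + r_b` -/
  | add (d a b : ℕ) : Cmd
  /-- `r_d := r_a - r_b`, truncated at zero -/
  | sub (d a b : ℕ) : Cmd
  /-- `r_d := r_a * r_b` -/
  | mul (d a b : ℕ) : Cmd
  /-- `r_d := ⌊r_a / r_b⌋`, and `0` if `r_b = 0` -/
  | div (d a b : ℕ) : Cmd
  /-- `r_d := mem[r_a]` -/
  | load (d a : ℕ) : Cmd
  /-- `mem[r_a] := r_b` -/
  | store (a b : ℕ) : Cmd
  /-- first `P`, then `Q` -/
  | seq (P Q : Cmd) : Cmd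
  /-- if `r_a ≠ 0` then `P` else `Q` -/
  | ite (a : ℕ) (P Q : Cmd) : Cmd
  /-- while `r_a ≠ 0` do `P` -/
  | loop (a : ℕ) (P : Cmd) : Cmd

/-- A machine state: the contents of the registers and of the memory cells. -/
structure State where
  reg : ℕ → ℕ
  mem : ℕ → ℕ

/-- Write `v` into register `d`. -/
def State.setReg (s : State) (d v : ℕ) : State :=
  { s with reg := Function.update s.reg d v }

/-- Write `v` into memory cell `a`. -/
def State.setMem (s : State) (a v : ℕ) : State :=
  { s with mem := Function.update s.mem a v }

/-- `Exec P s s' t`: started in state `s`, the program `P` halts in state `s'` at total cost `t`.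
Each elementary operation and each test costs one plus the numbers of binary digits of the values
and of the indirect addresses that it reads (logarithmic cost). -/
inductive Exec : Cmd → State → State → ℕ → Prop
  | const (s : State) (d c : ℕ) :
      Exec (.const d c) s (s.setReg d c) (1 + Nat.size c)
  | add (s : State) (d a b : ℕ) :
      Exec (.add d a b) s (s.setReg d (s.reg a + s.reg b))
        (1 + Nat.size (s.reg a) + Nat.size (s.reg b))
  | sub (s : State) (d a b : ℕ) :
      Exec (.sub d a b) s (s.setReg d (s.reg a - s.reg b))
        (1 + Nat.size (s.reg a) + Nat.size (s.reg b))
  | mul (s : State) (d a b : ℕ) :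
      Exec (.mul d a b) s (s.setReg d (s.reg a * s.reg b))
        (1 + Nat.size (s.reg a) + Nat.size (s.reg b))
  | div (s : State) (d a b : ℕ) :
      Exec (.div d a b) s (s.setReg d (s.reg a / s.reg b))
        (1 + Nat.size (s.reg a) + Nat.size (s.reg b))
  | load (s : State) (d a : ℕ) :
      Exec (.load d a) s (s.setReg d (s.mem (s.reg a)))
        (1 + Nat.size (s.reg a) + Nat.size (s.mem (s.reg a)))
  | store (s : State) (a b : ℕ) :
      Exec (.store a b) s (s.setMem (s.reg a) (s.reg b))
        (1 + Nat.size (s.reg a) + Nat.size (s.reg b))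
  | seq {P Q : Cmd} {s s' s'' : State} {t t' : ℕ} :
      Exec P s s' t → Exec Q s' s'' t' → Exec (.seq P Q) s s'' (t + t')
  | iteTrue {P Q : Cmd} {a : ℕ} {s s' : State} {t : ℕ} :
      s.reg a ≠ 0 → Exec P s s' t →
      Exec (.ite a P Q) s s' (1 + Nat.size (s.reg a) + t)
  | iteFalse {P Q : Cmd} {a : ℕ} {s s' : State} {t : ℕ} :
      s.reg a = 0 → Exec Q s s' t →
      Exec (.ite a P Q) s s' (1 + Nat.size (s.reg a) + t)
  | loopDone {P : Cmd} {a : ℕ} {s : State} :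
      s.reg a = 0 → Exec (.loop a P) s s (1 + Nat.size (s.reg a))
  | loopStep {P : Cmd} {a : ℕ} {s s' s'' : State} {t t' : ℕ} :
      s.reg a ≠ 0 → Exec P s s' t → Exec (.loop a P) s' s'' t' →
      Exec (.loop a P) s s'' (1 + Nat.size (s.reg a) + t + t')

/-- The initial state: the input word stands in the memory cells `0, 1, 2, …`; all other cells and
all registers hold `0`. -/
def init (w : List ℕ) : State where
  reg := fun _ => 0
  mem := fun i => w.getD i 0

/-- Number of bits of an input word, with one separator per entry. -/
def bitLength (w : List ℕ) : ℕ :=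
  (w.map fun x => Nat.size x + 1).sum

end RAM

/-! ### Two-valued makespan minimization with assignment constraints -/

/-- An instance of two-valued scheduling with assignment constraints: finitely many jobs and
machines, which jobs are big, and on which machines each job may be scheduled (the set `M_j`). -/
structure TwoValuedInstance where
  numJobs : ℕ
  numMachines : ℕ
  big : Fin numJobs → Bool
  allowed : Fin numJobs → Fin numMachines → Bool

namespace TwoValuedInstance

variable (I : TwoValuedInstance)

/-- The processing time of a job: `1` for big jobs, `1 / α` for small ones. -/
noncomputable def jobSize (α : ℝ) (j : Fin I.numJobs) : ℝ :=
  if I.big j = true then 1 else 1 / α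

/-- A schedule assigns each job `j` to one of the machines in `M_j`. -/
def Schedule : Type :=
  {σ : Fin I.numJobs → Fin I.numMachines // ∀ j, I.allowed j (σ j) = true}

/-- Each job can be scheduled somewhere: `M_j ≠ ∅` for all `j`. -/
def Feasible : Prop :=
  ∀ j, ∃ i, I.allowed j i = true

/-- The load of machine `i`: total processing time of the jobs that are assigned to it. -/
noncomputable def load (α : ℝ) (σ : I.Schedule) (i : Fin I.numMachines) : ℝ :=
  ∑ j ∈ Finset.univ.filter (fun j => σ.1 j = i), I.jobSize α j

/-- The makespan: the maximum load of a machine (`0` if there are no machines). -/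
noncomputable def makespan (α : ℝ) (σ : I.Schedule) : ℝ :=
  ⨆ i : Fin I.numMachines, I.load α σ i

/-- The optimal makespan: the minimum over the (finitely many) schedules. -/
noncomputable def opt (α : ℝ) : ℝ :=
  ⨅ σ : I.Schedule, I.makespan α σ

/-- The instance as an input word: the numbers of jobs and of machines, one bit per job for
its type (`1` is big), and the job-machine incidence matrix row by row. -/
def encode : List ℕ :=
  [I.numJobs, I.numMachines]
    ++ List.ofFn (fun j => (I.big j).toNat)
    ++ (List.ofFn fun j => List.ofFn fun i => (I.allowed j i).toNat).flatten

/-- The same input word, preceded by numerator and denominator of the rational `α > 0`. -/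
def encodeWith (α : ℚ) : List ℕ :=
  [α.num.toNat, α.den] ++ I.encode

/-- On the input word `w`, the program `P` halts at cost at most `T`, and then the memory cells
`0, 1, …` hold the machines to which the schedule `σ` assigns the jobs `0, 1, …`. -/
def Finds (P : RAM.Cmd) (w : List ℕ) (σ : I.Schedule) (T : ℕ) : Prop :=
  ∃ (s : RAM.State) (t : ℕ), RAM.Exec P (RAM.init w) s t ∧ t ≤ T ∧
    ∀ j : Fin I.numJobs, s.mem j = (σ.1 j : ℕ)

end TwoValuedInstance

/-- `f₁ = ⌈α⌉ / α` -/
noncomputable def f₁ (α : ℝ) : ℝ := (⌈α⌉ : ℝ) / α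

/-- `f₂ = ⌊α⌋ / α` -/
noncomputable def f₂ (α : ℝ) : ℝ := (⌊α⌋ : ℝ) / α

/-- The approximation ratio `min {1 + f₁ - 1/α, 1/f₂ + 1 - 1/⌊α⌋}`. -/
noncomputable def approxRatio (α : ℝ) : ℝ :=
  min (1 + f₁ α - 1 / α) (1 / f₂ α + 1 - 1 / (⌊α⌋ : ℝ))

/-! Measure sizes in units of the small job, so a big job has size `α`, and round it to an integer
`k`, either `⌊α⌋` or `⌈α⌉`, whichever gives the smaller of the two bounds. A local search treats the
rounded instance. It keeps a partial schedule (machine `0` holds the unassigned jobs), labels `d` on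
the machines, and a threshold `C` that is a lower bound for the rounded makespan of every schedule.
If a machine has load below `C` and label at most `m`, it pulls an admissible job from a place of
smaller label; if there is no such job, its label rises by one. If there is no such machine, `C`
rises by one.

Two facts survive all steps. A job can go only to machines whose label exceeds that of its current
place by at most one. Every non-empty machine holds some job without which its load would be below
`C`.

Raising `C` is sound by a gap argument (`PullRelabel.Inv.raise`): `m` machines cannot use all the
labels `1, …, m + 1`, so some `t` is missed. The jobs that are unassigned or lie below `t` can only
go to the machines below `t`. These all have load at least `C`, and at least one more job must go
there, so every schedule gives one of them load greater than `C`.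

At the end, rounded load minus one job is below `C` on each non-empty machine. Undoing the rounding
(`load_le_approxRatio_mul`) costs a factor `α / ⌊α⌋` or `⌈α⌉ / α`, and the extra job is paid by the
fact that a big job alone forces makespan at least `α`.

The potential of labels plus threshold grows in every step and is bounded by a polynomial in `N`,
`m` and the total rounded size. As `α` may be exponential in the input length, `k` is capped at `N +
1`. Beyond this value the comparison of rounded loads is lexicographic, and the cap costs only the
ratio `2 - 1 / α`, which never exceeds `approxRatio α`.

For the cost, the main program avoids multiplication, so each step lengthens numbers by a bounded
number of bits. Multiplications occur only in a prelude of constant length. -/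

/-! ### The pull-relabel process -/

namespace PullRelabel

open Finset

/-- Total size of the jobs `j < N` that `σ` puts on `v`. -/
def load (N : ℕ) (p σ : ℕ → ℕ) (v : ℕ) : ℕ :=
  ∑ j ∈ range N, if σ j = v then p j else 0

/-- `τ` puts every job `j < N` on an admissible machine in `1, …, m`. -/
def IsSchedule (N m : ℕ) (A : ℕ → ℕ → Prop) (τ : ℕ → ℕ) : Prop :=
  ∀ j < N, 1 ≤ τ j ∧ τ j ≤ m ∧ A j (τ j)

/-- `σ` is a partial schedule (`0` stands for unassigned), `d` a labelling of the machines by lower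
bounds for the distance from the unassigned jobs, and `C` a lower bound for the makespan of every
schedule. -/
structure Inv (N m : ℕ) (p : ℕ → ℕ) (A : ℕ → ℕ → Prop) (σ d : ℕ → ℕ) (C : ℕ) : Prop where
  le : ∀ j < N, σ j ≤ m
  adm : ∀ j < N, σ j ≠ 0 → A j (σ j)
  label_zero : d 0 = 0
  label_le : ∀ v ≤ m, d v ≤ m + 1
  label_step : ∀ j < N, ∀ v, 1 ≤ v → v ≤ m → A j v → d v ≤ d (σ j) + 1
  load_lt : ∀ j < N, σ j ≠ 0 → ∃ i < N, σ i = σ j ∧ load N p σ (σ j) < C + p i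
  lower : ∀ τ B, IsSchedule N m A τ → (∀ v, 1 ≤ v → v ≤ m → load N p τ v ≤ B) → C ≤ B

/-- The quantity that grows in every step of the process. -/
def potential (N m : ℕ) (σ d : ℕ → ℕ) (C : ℕ) : ℕ :=
  ∑ j ∈ range N, d (σ j) + ∑ v ∈ range (m + 1), d v + C

variable {N m : ℕ} {p : ℕ → ℕ} {A : ℕ → ℕ → Prop} {σ d : ℕ → ℕ} {C : ℕ}

theorem load_congr {σ' : ℕ → ℕ} (h : ∀ j < N, σ' j = σ j) (v : ℕ) :
    load N p σ' v = load N p σ v :=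
  sum_congr rfl fun j hj => by rw [h j (mem_range.1 hj)]

theorem potential_congr {σ' : ℕ → ℕ} (h : ∀ j < N, σ' j = σ j) :
    potential N m σ' d C = potential N m σ d C := by
  unfold potential
  rw [sum_congr rfl fun j hj => by rw [h j (mem_range.1 hj)]]

theorem Inv.congr {σ' : ℕ → ℕ} (H : Inv N m p A σ d C) (h : ∀ j < N, σ' j = σ j) :
    Inv N m p A σ' d C where
  le j hj := by rw [h j hj]; exact H.le j hj
  adm j hj := by rw [h j hj]; exact H.adm j hj
  label_zero := H.label_zero
  label_le := H.label_le
  label_step j hj := by rw [h j hj]; exact H.label_step j hj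
  load_lt j hj h0 := by
    rw [h j hj] at h0 ⊢
    obtain ⟨i, hi, h1, h2⟩ := H.load_lt j hj h0
    exact ⟨i, hi, by rw [h i hi, h1], by rwa [load_congr h]⟩
  lower := H.lower

theorem inv_zero : Inv N m p A (fun _ => 0) (fun _ => 0) 0 where
  le := by simp
  adm := by simp
  label_zero := rfl
  label_le := by simp
  label_step := by simp
  load_lt := by simp
  lower := by simp

theorem load_update {i : ℕ} (hi : i < N) (w v : ℕ) :
    load N p (Function.update σ i w) v + (if σ i = v then p i else 0) =
      load N p σ v + (if w = v then p i else 0) := by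
  unfold load
  rw [← add_sum_erase _ _ (mem_range.2 hi), ← add_sum_erase (range N) _ (mem_range.2 hi)]
  rw [sum_congr rfl fun j hj => by
    rw [Function.update_of_ne (ne_of_mem_erase hj)]]
  simp only [Function.update_self]
  ring

/-- Moving a job to a machine of load below the threshold. -/
theorem Inv.move (H : Inv N m p A σ d C) {i w : ℕ} (hi : i < N) (hwm : w ≤ m)
    (hA : A i w) (hload : load N p σ w < C) (hd : d (σ i) < d w) :
    Inv N m p A (Function.update σ i w) d C where
  le j hj := by
    rcases eq_or_ne j i with rfl | h
    · simpa using hwm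
    · simpa [h] using H.le j hj
  adm j hj := by
    rcases eq_or_ne j i with rfl | h
    · simpa using fun _ => hA
    · simpa [h] using H.adm j hj
  label_zero := H.label_zero
  label_le := H.label_le
  label_step j hj v h1 h2 h3 := by
    rcases eq_or_ne j i with rfl | h
    · have := H.label_step j hj v h1 h2 h3
      simp only [Function.update_self]
      omega
    · simpa [h] using H.label_step j hj v h1 h2 h3
  load_lt j hj h0 := by
    have hne : σ i ≠ w := fun h => by rw [h] at hd; exact lt_irrefl _ hd
    by_cases hjw : Function.update σ i w j = w
    -- On the receiving machine the moved job is the witness, since the load was below `C` before.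
    · refine ⟨i, hi, by simp [hjw], ?_⟩
      have := load_update (p := p) (σ := σ) hi w w
      rw [hjw]
      simp only [hne, if_false, if_true] at this
      omega
    · have hji : j ≠ i := fun h => hjw (by simp [h])
      rw [Function.update_of_ne hji] at h0 hjw ⊢
      obtain ⟨l, hl, h1, h2⟩ := H.load_lt j hj h0
      have hu := load_update (p := p) (σ := σ) hi w (σ j)
      rw [if_neg (Ne.symm hjw)] at hu
      -- If the witness of the losing machine was the moved job, the remaining load is below `C` and
      -- any job left there serves.
      rcases eq_or_ne l i with rfl | h
      · rw [if_pos h1] at hu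
        exact ⟨j, hj, by simp [hji], by omega⟩
      · exact ⟨l, hl, by simpa [h] using h1, by omega⟩
  lower := H.lower

theorem potential_move {i w : ℕ} (hi : i < N) (hd : d (σ i) < d w) :
    potential N m σ d C < potential N m (Function.update σ i w) d C := by
  unfold potential
  rw [← add_sum_erase _ _ (mem_range.2 hi),
    ← add_sum_erase (range N) (fun j => d (Function.update σ i w j)) (mem_range.2 hi)]
  rw [sum_congr rfl fun j hj => by
    rw [← Function.update_of_ne (ne_of_mem_erase hj) w σ]]
  simp only [Function.update_self]
  omega

/-- Raising the label of a machine that cannot take a job from a machine of smaller label. -/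
theorem Inv.relabel (H : Inv N m p A σ d C) {w : ℕ} (hw : 1 ≤ w) (hdw : d w ≤ m)
    (h : ∀ j < N, A j w → d w ≤ d (σ j)) :
    Inv N m p A σ (Function.update d w (d w + 1)) C where
  le := H.le
  adm := H.adm
  label_zero := by rw [Function.update_of_ne (by omega)]; exact H.label_zero
  label_le v hv := by
    rcases eq_or_ne v w with rfl | h
    · simpa using hdw
    · simpa [h] using H.label_le v hv
  label_step j hj v h1 h2 h3 := by
    have hle : d (σ j) ≤ Function.update d w (d w + 1) (σ j) := by
      rcases eq_or_ne (σ j) w with h | h <;> simp [h]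
    refine le_trans ?_ (Nat.add_le_add_right hle 1)
    rcases eq_or_ne v w with rfl | hv
    · simpa using h j hj h3
    · simpa [hv] using H.label_step j hj v h1 h2 h3
  load_lt := H.load_lt
  lower := H.lower

theorem potential_relabel {w : ℕ} (hw : w ≤ m) :
    potential N m σ d C < potential N m σ (Function.update d w (d w + 1)) C := by
  have hle : ∀ v, d v ≤ Function.update d w (d w + 1) v := fun v => by
    rcases eq_or_ne v w with h | h <;> simp [h]
  have h1 : ∑ j ∈ range N, d (σ j) ≤ ∑ j ∈ range N, Function.update d w (d w + 1) (σ j) :=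
    sum_le_sum fun j _ => hle _
  have h2 : ∑ v ∈ range (m + 1), d v < ∑ v ∈ range (m + 1), Function.update d w (d w + 1) v :=
    sum_lt_sum (fun j _ => hle _) ⟨w, mem_range.2 (by omega), by simp⟩
  unfold potential
  omega

theorem sum_load (R : Finset ℕ) :
    ∑ v ∈ R, load N p σ v = ∑ j ∈ range N, if σ j ∈ R then p j else 0 := by
  unfold load
  rw [sum_comm]
  exact sum_congr rfl fun j _ => by simp

/-- Raising the threshold when the machines of small load have the largest label. -/
theorem Inv.raise (H : Inv N m p A σ d C) (hp : ∀ j < N, 0 < p j) {i : ℕ} (hi : i < N)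
    (hσ : σ i = 0) (hsat : ∀ v, 1 ≤ v → v ≤ m → C ≤ load N p σ v ∨ m < d v) :
    Inv N m p A σ d (C + 1) where
  le := H.le
  adm := H.adm
  label_zero := H.label_zero
  label_le := H.label_le
  label_step := H.label_step
  load_lt j hj h0 := by
    obtain ⟨l, hl, h1, h2⟩ := H.load_lt j hj h0
    exact ⟨l, hl, h1, by omega⟩
  lower τ B hτ hB := by
    -- Pigeonhole: the `m` machines miss one of `m + 1` labels.
    obtain ⟨t, ht, hgap⟩ : ∃ t ∈ Icc 1 (m + 1), t ∉ (Icc 1 m).image d := by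
      by_contra! hcon
      have h1 := card_le_card hcon
      have h2 := (card_image_le (s := Icc 1 m) (f := d))
      simp at h1 h2
      omega
    rw [mem_Icc] at ht
    set R := (Icc 1 m).filter fun v => d v < t with hR
    -- Labels rise by at most one along an admissible assignment, so crossing `t` would require a
    -- machine labelled exactly `t`.
    have hclosed : ∀ j < N, d (σ j) < t → τ j ∈ R := fun j hj hlt => by
      obtain ⟨h1, h2, h3⟩ := hτ j hj
      have := H.label_step j hj _ h1 h2 h3
      have hne : d (τ j) ≠ t := fun h =>
        hgap (mem_image.2 ⟨τ j, mem_Icc.2 ⟨h1, h2⟩, h⟩)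
      simp only [hR, mem_filter, mem_Icc]
      exact ⟨⟨h1, h2⟩, by omega⟩
    have hlow : R.card * C ≤ ∑ v ∈ R, load N p σ v := by
      rw [← smul_eq_mul]
      refine card_nsmul_le_sum _ _ _ fun v hv => ?_
      simp only [hR, mem_filter, mem_Icc] at hv
      rcases hsat v hv.1.1 hv.1.2 with h | h
      · exact h
      · omega
    have hup : ∑ v ∈ R, load N p τ v ≤ R.card * B := by
      rw [← smul_eq_mul]
      refine sum_le_card_nsmul _ _ _ fun v hv => ?_
      simp only [hR, mem_filter, mem_Icc] at hv
      exact hB v hv.1.1 hv.1.2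
    -- Strictness comes from the unassigned job `i`: it counts for `τ` but not for `σ`.
    have hmid : ∑ v ∈ R, load N p σ v < ∑ v ∈ R, load N p τ v := by
      rw [sum_load, sum_load]
      refine sum_lt_sum (fun j hj => ?_) ⟨i, mem_range.2 hi, ?_⟩
      · by_cases h : σ j ∈ R
        · rw [if_pos h, if_pos (hclosed j (mem_range.1 hj) (by simp [hR] at h; exact h.2))]
        · rw [if_neg h]; exact Nat.zero_le _
      · rw [if_neg (by simp [hR, hσ]), if_pos (hclosed i hi (by rw [hσ, H.label_zero]; omega))]
        exact hp i hi
    have : R.card * C < R.card * B := by omega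
    exact Nat.lt_of_mul_lt_mul_left this

theorem Inv.le_sum (H : Inv N m p A σ d C) {τ : ℕ → ℕ} (hτ : IsSchedule N m A τ) :
    C ≤ ∑ j ∈ range N, p j :=
  H.lower τ _ hτ fun v _ _ => sum_le_sum fun j _ => by split_ifs <;> simp

/-- Together with the strict growth of the potential this bounds the number of steps. Some schedule
must exist, for otherwise `C` could rise forever. -/
theorem Inv.potential_le (H : Inv N m p A σ d C) {τ : ℕ → ℕ} (hτ : IsSchedule N m A τ) :
    potential N m σ d C ≤ (N + (m + 1)) * (m + 1) + ∑ j ∈ range N, p j := by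
  have h1 : ∑ j ∈ range N, d (σ j) ≤ N * (m + 1) := by
    simpa using sum_le_card_nsmul (range N) (fun j => d (σ j)) (m + 1)
      fun j hj => H.label_le _ (H.le j (mem_range.1 hj))
  have h2 : ∑ v ∈ range (m + 1), d v ≤ (m + 1) * (m + 1) := by
    simpa using sum_le_card_nsmul (range (m + 1)) d (m + 1)
      fun v hv => H.label_le _ (by simp at hv; omega)
  have := H.le_sum hτ
  unfold potential
  rw [add_mul]
  omega

end PullRelabel

/-! ### From the combinatorial invariant to the approximation ratio -/

/-- `k` is the rounded size of big jobs (in units of the small ones) that realizes the smaller of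
the two bounds in `approxRatio α`. -/
def IsBestRounding (α : ℝ) (k : ℕ) : Prop :=
  (k = ⌊α⌋₊ ∧ approxRatio α = 1 / f₂ α + 1 - 1 / (⌊α⌋ : ℝ)) ∨
    (k = ⌈α⌉₊ ∧ approxRatio α = 1 + f₁ α - 1 / α)

theorem exists_isBestRounding (α : ℝ) : ∃ k, IsBestRounding α k := by
  rcases le_total (1 + f₁ α - 1 / α) (1 / f₂ α + 1 - 1 / (⌊α⌋ : ℝ)) with h | h
  · exact ⟨_, Or.inr ⟨rfl, min_eq_left h⟩⟩
  · exact ⟨_, Or.inl ⟨rfl, min_eq_right h⟩⟩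

/-- `2 - 1 / α` is what both bounds would give without any rounding loss; it is the ratio achieved
when the big size is capped. -/
theorem two_sub_inv_le_approxRatio {α : ℝ} (hα : 1 < α) : 2 - 1 / α ≤ approxRatio α := by
  have h0 : 0 < α := by linarith
  have hf : (1 : ℝ) ≤ (⌊α⌋ : ℝ) := by exact_mod_cast Int.le_floor.2 (by simpa using hα.le)
  refine le_min ?_ ?_
  · have : 1 ≤ f₁ α := by
      rw [f₁, le_div_iff₀ h0, one_mul]
      exact Int.le_ceil α
    linarith
  · have h1 : 1 / f₂ α - 1 / (⌊α⌋ : ℝ) = (α - 1) / (⌊α⌋ : ℝ) := by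
      rw [f₂]; field_simp
    have h2 : (α - 1) / α ≤ (α - 1) / (⌊α⌋ : ℝ) :=
      div_le_div_of_nonneg_left (by linarith) (by linarith) (Int.floor_le α)
    have h3 : (α - 1) / α = 1 - 1 / α := by field_simp
    linarith

/-- A machine with `a` big and `b` small jobs whose rounded load exceeds the threshold `C` by less
than the rounded size of one of its jobs has load at most `approxRatio α` times the makespan of
any schedule (with `a' i` big and `b' i` small jobs on machine `i`). -/
theorem load_le_approxRatio_mul {α T : ℝ} (hα : 1 < α) {ι : Type*} [Nonempty ι] {a' b' : ι → ℕ}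
    (hT : ∀ i, a' i * α + b' i ≤ T) {N k₀ : ℕ} (hk : IsBestRounding α k₀) (hN : ∀ i, b' i ≤ N)
    {C : ℕ} (hC : ∀ B, (∀ i, min k₀ (N + 1) * a' i + b' i ≤ B) → C ≤ B)
    {a b : ℕ} (hb : b ≤ N) (hbig : 1 ≤ a → α ≤ T)
    (h : min k₀ (N + 1) * a + b ≤ C ∨ 1 ≤ a ∧ min k₀ (N + 1) * (a - 1) + b + 1 ≤ C) :
    a * α + b ≤ approxRatio α * T := by
  have h0 : 0 < α := by linarith
  have hT0 : 0 ≤ T := by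
    obtain ⟨i⟩ := ‹Nonempty ι›
    exact le_trans (by positivity) (hT i)
  have hρ := two_sub_inv_le_approxRatio hα
  have h1α : 1 / α < 1 := by rw [div_lt_one h0]; exact hα
  have hcast : 1 ≤ a → ((a - 1 : ℕ) : ℝ) = a - 1 := fun h => by
    rw [Nat.cast_sub h, Nat.cast_one]
  rcases le_or_gt k₀ (N + 1) with hkN | hkN
  · rw [min_eq_left hkN] at hC h
    rcases hk with ⟨rfl, hr⟩ | ⟨rfl, hr⟩
    · have hf : (1 : ℝ) ≤ (⌊α⌋₊ : ℝ) := by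
        exact_mod_cast Nat.le_floor (by simpa using hα.le)
      have hfα : (⌊α⌋₊ : ℝ) ≤ α := Nat.floor_le h0.le
      have hfi : ((⌊α⌋ : ℤ) : ℝ) = (⌊α⌋₊ : ℝ) := (natCast_floor_eq_intCast_floor h0.le).symm
      rw [hr, f₂, hfi]
      set f : ℝ := (⌊α⌋₊ : ℝ)
      -- Rounding down does not increase loads, and rounded loads are integers, so `⌊T⌋` is an
      -- admissible `B`.
      have hC' : (C : ℝ) ≤ T := by
        refine le_trans ?_ (Nat.floor_le hT0)
        refine Nat.cast_le.2 (hC _ fun i => Nat.le_floor (le_trans ?_ (hT i)))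
        push_cast
        nlinarith [mul_le_mul_of_nonneg_right hfα (Nat.cast_nonneg (α := ℝ) (a' i))]
      -- Restoring the true sizes stretches a rounded load by at most `α / f`.
      have key : ∀ x y : ℝ, 0 ≤ y → x * α + y ≤ (f * x + y) * (α / f) := fun x y hy => by
        have h1 : 1 ≤ α / f := (one_le_div (by linarith)).2 hfα
        have h2 : (f * x + y) * (α / f) = x * α + y * (α / f) := by field_simp
        nlinarith
      have hαf : 0 ≤ α / f := by positivity
      have hinv : 1 / f ≤ 1 := by rw [div_le_one (by linarith)]; exact hf
      have hgoal : (1 / (f / α) + 1 - 1 / f) * T = α / f * T + (1 - 1 / f) * T := by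
        rw [one_div_div]; ring
      rw [hgoal]
      rcases h with h | ⟨ha, h⟩
      · have h' : f * a + b ≤ C := by
          have h := (Nat.cast_le (α := ℝ)).2 h
          push_cast at h
          exact h
        have := key a b (by positivity)
        have h3 : (f * a + b) * (α / f) ≤ α / f * T := by
          rw [mul_comm]; exact mul_le_mul_of_nonneg_left (by linarith) hαf
        nlinarith
      · have h' : f * (a - 1) + b + 1 ≤ C := by
          have h := (Nat.cast_le (α := ℝ)).2 h
          simp only [Nat.cast_add, Nat.cast_mul, Nat.cast_one, hcast ha] at h
          exact h
        have := key (a - 1) b (by positivity)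
        have h3 : (f * (a - 1) + b) * (α / f) ≤ α / f * (T - 1) := by
          rw [mul_comm]; exact mul_le_mul_of_nonneg_left (by linarith) hαf
        -- The removed big job adds `α`, of which `α / f` is saved by the `+ 1` in `h'`; the rest is
        -- charged to `T ≥ α`.
        have h4 : (1 - 1 / f) * α ≤ (1 - 1 / f) * T :=
          mul_le_mul_of_nonneg_left (hbig ha) (by linarith)
        have h5 : (1 - 1 / f) * α = α - α / f := by ring
        linarith
    · have hfα : α ≤ (⌈α⌉₊ : ℝ) := Nat.le_ceil α
      have hfi : ((⌈α⌉ : ℤ) : ℝ) = (⌈α⌉₊ : ℝ) := (natCast_ceil_eq_intCast_ceil h0.le).symm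
      rw [hr, f₁, hfi]
      set f : ℝ := (⌈α⌉₊ : ℝ)
      have h1 : 1 ≤ f / α := (one_le_div h0).2 hfα
      -- Rounding up stretches the loads of the compared schedule by at most `f / α`, so here the
      -- loss is in `C`.
      have hC' : (C : ℝ) ≤ f / α * T := by
        refine le_trans ?_ (Nat.floor_le (by positivity))
        refine Nat.cast_le.2 (hC _ fun i => Nat.le_floor ?_)
        have h2 := mul_le_mul_of_nonneg_left (hT i) (by positivity : 0 ≤ f / α)
        have h3 : f / α * (a' i * α + b' i) = f * a' i + f / α * b' i := by field_simp
        have h4 : (0 : ℝ) ≤ b' i := Nat.cast_nonneg _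
        push_cast
        nlinarith
      have hgoal : (1 + f / α - 1 / α) * T = f / α * T + (1 - 1 / α) * T := by ring
      rw [hgoal]
      rcases h with h | ⟨ha, h⟩
      · have h' : f * a + b ≤ C := by
          have h := (Nat.cast_le (α := ℝ)).2 h
          push_cast at h
          exact h
        have h2 : α * a ≤ f * a := mul_le_mul_of_nonneg_right hfα (by positivity)
        nlinarith
      · have h' : f * (a - 1) + b + 1 ≤ C := by
          have h := (Nat.cast_le (α := ℝ)).2 h
          simp only [Nat.cast_add, Nat.cast_mul, Nat.cast_one, hcast ha] at h
          exact h
        have ha' : (1 : ℝ) ≤ a := by exact_mod_cast ha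
        have h2 : α * (a - 1) ≤ f * (a - 1) := mul_le_mul_of_nonneg_right hfα (by linarith)
        have h4 : (1 - 1 / α) * α ≤ (1 - 1 / α) * T :=
          mul_le_mul_of_nonneg_left (hbig ha) (by linarith)
        have h5 : (1 - 1 / α) * α = α - 1 := by field_simp
        linarith
  -- The capped case: a big job counts `N + 1`, more than all small jobs together, and the true `α`
  -- is at least `N + 1` as well.
  · rw [min_eq_right hkN.le] at hC h
    have hNα : (N : ℝ) + 1 ≤ α := by
      rcases hk with ⟨rfl, -⟩ | ⟨rfl, -⟩
      · exact le_trans (by exact_mod_cast hkN.le) (Nat.floor_le h0.le)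
      · have := Nat.lt_ceil.1 hkN
        push_cast at this
        exact this.le
    obtain ⟨i, hi⟩ : ∃ i, C ≤ (N + 1) * a' i + b' i := by
      by_contra! hcon
      obtain ⟨i⟩ := ‹Nonempty ι›
      have h1 := hC (C - 1) fun i => Nat.le_sub_one_of_lt (hcon i)
      have h2 := hcon i
      omega
    have hTi := hT i
    have hbR : (b : ℝ) ≤ N := by exact_mod_cast hb
    have hb'R : (0 : ℝ) ≤ b' i := Nat.cast_nonneg _
    have hb' := hN i
    -- the comparison of rounded loads is lexicographic
    have hlex : ∀ x y : ℕ, (N + 1) * x + y ≤ (N + 1) * a' i + b' i →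
        x = a' i ∧ y ≤ b' i ∨ x + 1 ≤ a' i := fun x y hxy => by
      rcases lt_trichotomy x (a' i) with h1 | h1 | h1
      · exact Or.inr h1
      · subst h1; exact Or.inl ⟨rfl, by omega⟩
      · have := Nat.mul_le_mul_left (N + 1) h1
        rw [Nat.mul_succ] at this
        omega
    rcases h with h | ⟨ha, h⟩
    · have hTT : (a : ℝ) * α + b ≤ T := by
        rcases hlex a b (h.trans hi) with ⟨h1, h2⟩ | h1
        · have h2' : (b : ℝ) ≤ b' i := by exact_mod_cast h2
          rw [h1]
          linarith
        · have h1' : (a : ℝ) + 1 ≤ a' i := by exact_mod_cast h1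
          nlinarith
      nlinarith
    -- Apply the lexicographic comparison with one big job traded for one small job.
    · have hTT : (a : ℝ) * α + b ≤ T + α - 1 := by
        rcases hlex (a - 1) (b + 1) (by omega) with ⟨h1, h2⟩ | h1
        · have h2' : (b : ℝ) + 1 ≤ b' i := by exact_mod_cast h2
          rw [← h1, hcast ha] at hTi
          linarith
        · have h1' : (a : ℝ) ≤ a' i := by exact_mod_cast (by omega : a ≤ a' i)
          nlinarith
      have h4 : (1 - 1 / α) * α ≤ (1 - 1 / α) * T :=
        mul_le_mul_of_nonneg_left (hbig ha) (by linarith)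
      have h5 : (1 - 1 / α) * α = α - 1 := by field_simp
      nlinarith

/-! ### Transfer of the invariant to schedules of an instance -/

namespace TwoValuedInstance

open Finset

variable (I : TwoValuedInstance)

/-- The rounded job sizes. -/
def roundedSize (k j : ℕ) : ℕ :=
  if h : j < I.numJobs then if I.big ⟨j, h⟩ = true then k else 1 else 1

/-- Job `j` may be scheduled on the machine of index `v - 1`. -/
def Adm (j v : ℕ) : Prop :=
  ∃ (hj : j < I.numJobs) (hv : v - 1 < I.numMachines), I.allowed ⟨j, hj⟩ ⟨v - 1, hv⟩ = true

/-- The number of jobs of the given type on machine `i`. -/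
def count (S : I.Schedule) (t : Bool) (i : Fin I.numMachines) : ℕ :=
  #{j | S.1 j = i ∧ I.big j = t}

theorem count_le (S : I.Schedule) (t : Bool) (i : Fin I.numMachines) :
    I.count S t i ≤ I.numJobs :=
  (card_filter_le _ _).trans (by simp)

theorem load_eq (α : ℝ) (S : I.Schedule) (i : Fin I.numMachines) :
    I.load α S i = I.count S true i + I.count S false i * (1 / α) := by
  simp [load, jobSize, sum_ite, count, filter_filter]

/-- A schedule as a map on indices, in which `0` is reserved for unassigned jobs. -/
def toIndices (S : I.Schedule) (j : ℕ) : ℕ :=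
  if h : j < I.numJobs then S.1 ⟨j, h⟩ + 1 else 0

theorem isSchedule_toIndices (S : I.Schedule) :
    PullRelabel.IsSchedule I.numJobs I.numMachines I.Adm (I.toIndices S) := by
  intro j hj
  simp only [toIndices, hj, dif_pos]
  exact ⟨by omega, (S.1 ⟨j, hj⟩).2, hj, by simp, S.2 _⟩

theorem rounded_load_eq (k : ℕ) (S : I.Schedule) {σ : ℕ → ℕ}
    (hσ : ∀ j : Fin I.numJobs, σ j = S.1 j + 1) (i : Fin I.numMachines) :
    PullRelabel.load I.numJobs (I.roundedSize k) σ (i + 1) =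
      k * I.count S true i + I.count S false i := by
  rw [PullRelabel.load, sum_range]
  have : ∀ j : Fin I.numJobs, (if σ j = i + 1 then I.roundedSize k j else 0) =
      if S.1 j = i then if I.big j = true then k else 1 else 0 := fun j => by
    simp [hσ, roundedSize, Fin.ext_iff]
  simp only [this]
  rw [← sum_filter]
  simp [sum_ite, count, filter_filter, mul_comm]

/-- The comparison is made with an arbitrary schedule `τ`, where `T` is `α` times its makespan. The
witness job from `load_lt` is small or big, which gives the two alternatives of
`load_le_approxRatio_mul`. -/
theorem makespan_le_of_inv {α : ℝ} (hα : 1 < α) {k : ℕ} (hk : IsBestRounding α k)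
    (S : I.Schedule) {σ d : ℕ → ℕ} {C : ℕ} (hσ : ∀ j : Fin I.numJobs, σ j = S.1 j + 1)
    (H : PullRelabel.Inv I.numJobs I.numMachines (I.roundedSize (min k (I.numJobs + 1))) I.Adm
      σ d C) :
    I.makespan α S ≤ approxRatio α * I.opt α := by
  have h0 : 0 < α := by linarith
  have hρ : 0 ≤ approxRatio α := by
    have h1 : 1 / α < 1 := by rw [div_lt_one h0]; exact hα
    linarith [two_sub_inv_le_approxRatio hα]
  have : Nonempty I.Schedule := ⟨S⟩
  rw [opt, Real.mul_iInf_of_nonneg hρ]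
  refine le_ciInf fun τ => ?_
  rcases isEmpty_or_nonempty (Fin I.numMachines) with hm | hm
  · simp [makespan]
  refine ciSup_le fun i => ?_
  have hτ : ∀ i, I.load α τ i ≤ I.makespan α τ := fun i =>
    le_ciSup (f := I.load α τ) (Set.finite_range _).bddAbove i
  have hmul : ∀ (S : I.Schedule) i,
      α * I.load α S i = I.count S true i * α + I.count S false i := fun S i => by
    rw [load_eq]; field_simp
  have hτ0 : 0 ≤ I.makespan α τ := (by
    rw [load_eq]; positivity : 0 ≤ I.load α τ i).trans (hτ i)
  have hT : ∀ i, I.count τ true i * α + I.count τ false i ≤ α * I.makespan α τ := fun i => by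
    rw [← hmul]; exact mul_le_mul_of_nonneg_left (hτ i) h0.le
  suffices α * I.load α S i ≤ approxRatio α * (α * I.makespan α τ) by
    refine le_of_mul_le_mul_left ?_ h0
    linarith
  by_cases hne : ∃ j, S.1 j = i
  swap
  · have : ∀ j, ¬ S.1 j = i := fun j hj => hne ⟨j, hj⟩
    have h1 : I.load α S i = 0 := by simp [load, this]
    rw [h1, mul_zero]
    positivity
  obtain ⟨j, hj⟩ := hne
  rw [hmul]
  -- A big job of `S` is also placed somewhere by `τ`.
  have hbig : 1 ≤ I.count S true i → α ≤ α * I.makespan α τ := fun hc => by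
    obtain ⟨l, hl⟩ := card_pos.1 hc
    have hl2 : I.big l = true := (mem_filter.1 hl).2.2
    refine le_trans ?_ (hT (τ.1 l))
    have : 1 ≤ I.count τ true (τ.1 l) := card_pos.2 ⟨l, by simp [hl2]⟩
    have h1 : (1 : ℝ) ≤ I.count τ true (τ.1 l) := by exact_mod_cast this
    have h2 : (0 : ℝ) ≤ I.count τ false (τ.1 l) := Nat.cast_nonneg _
    nlinarith
  refine load_le_approxRatio_mul hα hT hk (fun i => I.count_le τ false i) (C := C) ?_
    (I.count_le S false i) hbig ?_
  · intro B hB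
    refine H.lower _ B (I.isSchedule_toIndices τ) fun v h1 h2 => ?_
    have := I.rounded_load_eq (min k (I.numJobs + 1)) τ (σ := I.toIndices τ)
      (fun j => by simp [toIndices]) ⟨v - 1, by omega⟩
    rw [show ((⟨v - 1, by omega⟩ : Fin I.numMachines) : ℕ) + 1 = v by simp; omega] at this
    rw [this]
    exact hB _
  · obtain ⟨l, hl, h1, h2⟩ := H.load_lt j j.2 (by rw [hσ]; omega)
    rw [hσ j, hj, I.rounded_load_eq _ S hσ] at h2
    have hli : S.1 ⟨l, hl⟩ = i := by
      have := hσ ⟨l, hl⟩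
      rw [h1, hσ j, hj] at this
      exact Fin.ext (by simpa using this.symm)
    simp only [roundedSize, hl, dif_pos] at h2
    split_ifs at h2 with hb
    · have hc : 1 ≤ I.count S true i := card_pos.2 ⟨⟨l, hl⟩, by simp [hli, hb]⟩
      obtain ⟨c, hc'⟩ := Nat.exists_eq_add_of_le hc
      refine Or.inr ⟨hc, ?_⟩
      rw [hc'] at h2 ⊢
      rw [Nat.add_sub_cancel_left]
      rw [mul_add] at h2
      omega
    · exact Or.inl (by omega)

end TwoValuedInstance

/-! ### Verification of random access machine programs -/

namespace RAM

/-- All numbers that are stored in the state have at most `S` bits. -/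
def Bounded (S : ℕ) (s : State) : Prop :=
  (∀ r, Nat.size (s.reg r) ≤ S) ∧ ∀ a, Nat.size (s.mem a) ≤ S

theorem Bounded.mono {S S' : ℕ} {s : State} (h : Bounded S s) (hS : S ≤ S') : Bounded S' s :=
  ⟨fun r => (h.1 r).trans hS, fun a => (h.2 a).trans hS⟩

theorem Bounded.setReg {S : ℕ} {s : State} (h : Bounded S s) {d v : ℕ} (hv : Nat.size v ≤ S) :
    Bounded S (s.setReg d v) := by
  refine ⟨fun r => ?_, h.2⟩
  rcases eq_or_ne r d with rfl | hr
  · simpa [State.setReg] using hv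
  · simpa [State.setReg, hr] using h.1 r

theorem Bounded.setMem {S : ℕ} {s : State} (h : Bounded S s) {a v : ℕ} (hv : Nat.size v ≤ S) :
    Bounded S (s.setMem a v) := by
  refine ⟨h.1, fun r => ?_⟩
  rcases eq_or_ne r a with rfl | hr
  · simpa [State.setMem] using hv
  · simpa [State.setMem, hr] using h.2 r

theorem size_add_le {x y S : ℕ} (hx : Nat.size x ≤ S) (hy : Nat.size y ≤ S) :
    Nat.size (x + y) ≤ S + 1 := by
  rw [Nat.size_le] at *
  rw [pow_succ]
  omega

theorem size_mul_le {x y S : ℕ} (hx : Nat.size x ≤ S) (hy : Nat.size y ≤ S) :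
    Nat.size (x * y) ≤ 2 * S := by
  rw [Nat.size_le] at *
  rw [two_mul, pow_add]
  exact Nat.mul_lt_mul'' hx hy

namespace Cmd

/-- The effect of a program without loops. -/
def eval : Cmd → State → State
  | const d c, s => s.setReg d c
  | add d a b, s => s.setReg d (s.reg a + s.reg b)
  | sub d a b, s => s.setReg d (s.reg a - s.reg b)
  | mul d a b, s => s.setReg d (s.reg a * s.reg b)
  | div d a b, s => s.setReg d (s.reg a / s.reg b)
  | load d a, s => s.setReg d (s.mem (s.reg a))
  | store a b, s => s.setMem (s.reg a) (s.reg b)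
  | seq P Q, s => Q.eval (P.eval s)
  | ite a P Q, s => if s.reg a = 0 then Q.eval s else P.eval s
  | loop _ _, s => s

/-- An upper bound for the number of steps of a program without loops (a constant is charged for
its length). -/
def len : Cmd → ℕ
  | const _ c => Nat.size c + 1
  | seq P Q => P.len + Q.len
  | ite _ P Q => P.len + Q.len + 1
  | _ => 1

/-- The program contains no loops. -/
def loopFree : Cmd → Bool
  | seq P Q => P.loopFree && Q.loopFree
  | ite _ P Q => P.loopFree && Q.loopFree
  | loop _ _ => false
  | _ => true

/-- The program contains no multiplications. -/
def mulFree : Cmd → Bool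
  | mul _ _ _ => false
  | seq P Q => P.mulFree && Q.mulFree
  | ite _ P Q => P.mulFree && Q.mulFree
  | loop _ P => P.mulFree
  | _ => true

/-- The program does not write to memory. -/
def storeFree : Cmd → Bool
  | store _ _ => false
  | seq P Q => P.storeFree && Q.storeFree
  | ite _ P Q => P.storeFree && Q.storeFree
  | loop _ P => P.storeFree
  | _ => true

/-- The program does not write to the registers below `n`. -/
def above (n : ℕ) : Cmd → Bool
  | const d _ => n ≤ d
  | add d _ _ => n ≤ d
  | sub d _ _ => n ≤ d
  | mul d _ _ => n ≤ d
  | div d _ _ => n ≤ d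
  | load d _ => n ≤ d
  | store _ _ => true
  | seq P Q => P.above n && Q.above n
  | ite _ P Q => P.above n && Q.above n
  | loop _ P => P.above n

end Cmd

theorem Exec.reg_eq {P : Cmd} {s s' : State} {t n : ℕ} (h : Exec P s s' t)
    (hP : P.above n = true) {r : ℕ} (hr : r < n) : s'.reg r = s.reg r := by
  induction h with
  | seq _ _ ih1 ih2 =>
    simp only [Cmd.above, Bool.and_eq_true] at hP
    rw [ih2 hP.2, ih1 hP.1]
  | iteTrue _ _ ih => simp only [Cmd.above, Bool.and_eq_true] at hP; exact ih hP.1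
  | iteFalse _ _ ih => simp only [Cmd.above, Bool.and_eq_true] at hP; exact ih hP.2
  | loopDone => rfl
  | loopStep _ _ _ ih1 ih2 => rw [ih2 hP, ih1 hP]
  | store => rfl
  | _ =>
    simp only [Cmd.above, decide_eq_true_eq] at hP
    simp only [State.setReg]
    rw [Function.update_of_ne (by omega)]

theorem Exec.mem_eq {P : Cmd} {s s' : State} {t : ℕ} (h : Exec P s s' t)
    (hP : P.storeFree = true) : s'.mem = s.mem := by
  induction h with
  | seq _ _ ih1 ih2 =>
    simp only [Cmd.storeFree, Bool.and_eq_true] at hP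
    rw [ih2 hP.2, ih1 hP.1]
  | iteTrue _ _ ih => simp only [Cmd.storeFree, Bool.and_eq_true] at hP; exact ih hP.1
  | iteFalse _ _ ih => simp only [Cmd.storeFree, Bool.and_eq_true] at hP; exact ih hP.2
  | loopStep _ _ _ ih1 ih2 => rw [ih2 hP, ih1 hP]
  | store => simp [Cmd.storeFree] at hP
  | _ => rfl

/-- `P` halts with result `s'`, and `n` bounds both the number of its steps and the growth of the
bit lengths. -/
def Runs (P : Cmd) (s s' : State) (n : ℕ) : Prop :=
  ∃ t, Exec P s s' t ∧ ∀ S, Bounded S s → t ≤ n * (3 + 2 * (S + n)) ∧ Bounded (S + n) s'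

theorem Runs.reg_eq {P : Cmd} {s s' : State} {n b : ℕ} (h : Runs P s s' n)
    (hP : P.above b = true) {r : ℕ} (hr : r < b) : s'.reg r = s.reg r := by
  obtain ⟨t, h, -⟩ := h
  exact h.reg_eq hP hr

theorem Runs.mem_eq {P : Cmd} {s s' : State} {n : ℕ} (h : Runs P s s' n)
    (hP : P.storeFree = true) : s'.mem = s.mem := by
  obtain ⟨t, h, -⟩ := h
  exact h.mem_eq hP

theorem Runs.mono {P : Cmd} {s s' : State} {n n' : ℕ} (h : Runs P s s' n) (hn : n ≤ n') :
    Runs P s s' n' := by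
  obtain ⟨t, h, hb⟩ := h
  refine ⟨t, h, fun S hS => ?_⟩
  obtain ⟨h1, h2⟩ := hb S hS
  exact ⟨h1.trans (Nat.mul_le_mul hn (by omega)), h2.mono (by omega)⟩

/-- One number suffices for steps and bit growth because both add up under composition; the second
program starts with numbers of at most `S + n` bits. -/
theorem Runs.seq {P Q : Cmd} {s s' s'' : State} {n n' : ℕ} (h : Runs P s s' n)
    (h' : Runs Q s' s'' n') : Runs (.seq P Q) s s'' (n + n') := by
  obtain ⟨t, h, hb⟩ := h
  obtain ⟨t', h', hb'⟩ := h'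
  refine ⟨t + t', h.seq h', fun S hS => ?_⟩
  obtain ⟨h1, h2⟩ := hb S hS
  obtain ⟨h3, h4⟩ := hb' _ h2
  refine ⟨?_, h4.mono (by omega)⟩
  rw [add_mul]
  refine Nat.add_le_add (h1.trans (Nat.mul_le_mul_left _ (by omega)))
    (h3.trans (Nat.mul_le_mul_left _ (by omega)))

theorem branch_cost {S n x t : ℕ} (hx : x ≤ S) (ht : t ≤ n * (3 + 2 * (S + n))) :
    1 + x + t ≤ (n + 1) * (3 + 2 * (S + (n + 1))) := by
  have : n * (3 + 2 * (S + n)) ≤ n * (3 + 2 * (S + (n + 1))) :=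
    Nat.mul_le_mul_left _ (by omega)
  rw [add_mul]
  omega

theorem Runs.iteTrue {P Q : Cmd} {a n : ℕ} {s s' : State} (ha : s.reg a ≠ 0)
    (h : Runs P s s' n) : Runs (.ite a P Q) s s' (n + 1) := by
  obtain ⟨t, h, hb⟩ := h
  refine ⟨_, h.iteTrue ha, fun S hS => ?_⟩
  obtain ⟨h1, h2⟩ := hb S hS
  exact ⟨branch_cost (hS.1 a) h1, h2.mono (by omega)⟩

theorem Runs.iteFalse {P Q : Cmd} {a n : ℕ} {s s' : State} (ha : s.reg a = 0)
    (h : Runs Q s s' n) : Runs (.ite a P Q) s s' (n + 1) := by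
  obtain ⟨t, h, hb⟩ := h
  refine ⟨_, h.iteFalse ha, fun S hS => ?_⟩
  obtain ⟨h1, h2⟩ := hb S hS
  exact ⟨branch_cost (hS.1 a) h1, h2.mono (by omega)⟩

theorem Runs.loopDone {P : Cmd} {a : ℕ} {s : State} (ha : s.reg a = 0) :
    Runs (.loop a P) s s 1 := by
  refine ⟨_, .loopDone ha, fun S hS => ⟨?_, hS.mono (by omega)⟩⟩
  have := hS.1 a
  omega

theorem Runs.loopStep {P : Cmd} {a n n' : ℕ} {s s' s'' : State} (ha : s.reg a ≠ 0)
    (h : Runs P s s' n) (h' : Runs (.loop a P) s' s'' n') :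
    Runs (.loop a P) s s'' (n + n' + 1) := by
  obtain ⟨t, h1, hb⟩ := h.seq h'
  cases h1 with
  | seq h1 h2 =>
    refine ⟨_, .loopStep ha h1 h2, fun S hS => ?_⟩
    obtain ⟨h3, h4⟩ := hb S hS
    refine ⟨?_, h4.mono (by omega)⟩
    rw [add_assoc]
    exact branch_cost (hS.1 a) h3

/-- A loop in which the quantity `μ` decreases. -/
theorem exists_runs_loop {a b : ℕ} {P : Cmd} (Inv : State → Prop) (μ : State → ℕ)
    (step : ∀ s, Inv s → s.reg a ≠ 0 → ∃ s', Runs P s s' b ∧ Inv s' ∧ μ s' < μ s) (s : State)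
    (hs : Inv s) :
    ∃ s', Runs (.loop a P) s s' (μ s * (b + 1) + 1) ∧ Inv s' ∧ s'.reg a = 0 := by
  induction h : μ s using Nat.strong_induction_on generalizing s with
  | _ n ih =>
    by_cases ha : s.reg a = 0
    · exact ⟨s, (Runs.loopDone ha).mono (by omega), hs, ha⟩
    · obtain ⟨s₁, h1, h2, h3⟩ := step s hs ha
      obtain ⟨s₂, h4, h5, h6⟩ := ih _ (h ▸ h3) s₁ h2 rfl
      refine ⟨s₂, (Runs.loopStep ha h1 h4).mono ?_, h5, h6⟩
      have : (μ s₁ + 1) * (b + 1) ≤ n * (b + 1) := Nat.mul_le_mul_right _ (by omega)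
      rw [add_mul] at this
      omega

/-- A loop that changes neither the memory nor the registers below `c`. -/
theorem exists_runs_loop_frame {a b c : ℕ} {P : Cmd} (hc : P.above c = true)
    (hP : P.storeFree = true) (Inv : State → Prop) (μ : State → ℕ) (s₀ : State)
    (step : ∀ s, s.mem = s₀.mem → (∀ r < c, s.reg r = s₀.reg r) → Inv s → s.reg a ≠ 0 →
      ∃ s', Runs P s s' b ∧ Inv s' ∧ μ s' < μ s) (h₀ : Inv s₀) :
    ∃ s', Runs (.loop a P) s₀ s' (μ s₀ * (b + 1) + 1) ∧ s'.mem = s₀.mem ∧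
      (∀ r < c, s'.reg r = s₀.reg r) ∧ Inv s' ∧ s'.reg a = 0 := by
  obtain ⟨s', h1, ⟨h2, h3, h4⟩, h5⟩ := exists_runs_loop (a := a) (b := b) (P := P)
    (fun s => s.mem = s₀.mem ∧ (∀ r < c, s.reg r = s₀.reg r) ∧ Inv s) μ
    (fun s hs ha => by
      obtain ⟨s', h1, h2, h3⟩ := step s hs.1 hs.2.1 hs.2.2 ha
      exact ⟨s', h1, ⟨(h1.mem_eq hP).trans hs.1,
        fun r hr => (h1.reg_eq hc hr).trans (hs.2.1 r hr), h2⟩, h3⟩)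
    s₀ ⟨rfl, fun _ _ => rfl, h₀⟩
  exact ⟨s', h1, h2, h3, h4, h5⟩

/-- The effect of a program without loops and multiplications. -/
theorem runs_eval {P : Cmd} (hl : P.loopFree = true) (hm : P.mulFree = true) (s : State) :
    Runs P s (P.eval s) P.len := by
  induction P generalizing s with
  | const d c =>
    refine ⟨_, .const s d c, fun S hS => ⟨?_, ?_⟩⟩
    · simp only [Cmd.len, add_mul]
      nlinarith [Nat.zero_le (Nat.size c)]
    · exact (hS.mono (Nat.le_add_right _ _)).setReg (by simp [Cmd.len]; omega)
  | add d a b =>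
    refine ⟨_, .add s d a b, fun S hS => ⟨?_, ?_⟩⟩
    · have := hS.1 a; have := hS.1 b
      simp only [Cmd.len]; omega
    · exact (hS.mono (Nat.le_add_right _ _)).setReg (size_add_le (hS.1 a) (hS.1 b))
  | sub d a b =>
    refine ⟨_, .sub s d a b, fun S hS => ⟨?_, ?_⟩⟩
    · have := hS.1 a; have := hS.1 b
      simp only [Cmd.len]; omega
    · exact (hS.setReg ((Nat.size_le_size (Nat.sub_le _ _)).trans (hS.1 a))).mono
        (Nat.le_add_right _ _)
  | mul d a b => simp [Cmd.mulFree] at hm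
  | div d a b =>
    refine ⟨_, .div s d a b, fun S hS => ⟨?_, ?_⟩⟩
    · have := hS.1 a; have := hS.1 b
      simp only [Cmd.len]; omega
    · exact (hS.setReg ((Nat.size_le_size (Nat.div_le_self _ _)).trans (hS.1 a))).mono
        (Nat.le_add_right _ _)
  | load d a =>
    refine ⟨_, .load s d a, fun S hS => ⟨?_, ?_⟩⟩
    · have := hS.1 a; have := hS.2 (s.reg a)
      simp only [Cmd.len]; omega
    · exact (hS.setReg (hS.2 _)).mono (Nat.le_add_right _ _)
  | store a b =>
    refine ⟨_, .store s a b, fun S hS => ⟨?_, ?_⟩⟩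
    · have := hS.1 a; have := hS.1 b
      simp only [Cmd.len]; omega
    · exact (hS.setMem (hS.1 b)).mono (Nat.le_add_right _ _)
  | seq P Q ihP ihQ =>
    simp only [Cmd.loopFree, Cmd.mulFree, Bool.and_eq_true] at hl hm
    exact (ihP hl.1 hm.1 s).seq (ihQ hl.2 hm.2 _)
  | ite a P Q ihP ihQ =>
    simp only [Cmd.loopFree, Cmd.mulFree, Bool.and_eq_true] at hl hm
    simp only [Cmd.eval, Cmd.len]
    split_ifs with h
    · exact (Runs.iteFalse h (ihQ hl.2 hm.2 s)).mono (by omega)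
    · exact (Runs.iteTrue h (ihP hl.1 hm.1 s)).mono (by omega)
  | loop a P => simp [Cmd.loopFree] at hl

theorem exec_eval_of_atom {Q : Cmd} {S : ℕ} {s : State} (hs : Bounded S s) (h1 : Q.len = 1)
    (h2 : Q.loopFree = true) (h3 : Q.mulFree = true)
    (h4 : ∀ {t}, Exec Q s (Q.eval s) t → t ≤ 1 + 2 * S) (hS : 1 ≤ S) :
    ∃ t, Exec Q s (Q.eval s) t ∧ t ≤ Q.len * (1 + 2 * (2 ^ Q.len * S)) ∧
      Bounded (2 ^ Q.len * S) (Q.eval s) := by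
  obtain ⟨t, h5, h6⟩ := runs_eval h2 h3 s
  refine ⟨t, h5, ?_, (h6 S hs).2.mono ?_⟩
  · have := h4 h5
    rw [h1]; omega
  · rw [h1]; omega

/-- The effect and the cost of a program without loops. -/
theorem exec_eval {P : Cmd} (hl : P.loopFree = true) {S : ℕ} (hS : 1 ≤ S) {s : State}
    (hs : Bounded S s) : ∃ t, Exec P s (P.eval s) t ∧ t ≤ P.len * (1 + 2 * (2 ^ P.len * S)) ∧
      Bounded (2 ^ P.len * S) (P.eval s) := by
  induction P generalizing s S with
  | const d c =>
    have h2 : Nat.size c + 1 ≤ 2 ^ (Nat.size c + 1) := Nat.lt_two_pow_self.le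
    have h3 : 2 ^ (Nat.size c + 1) * 1 ≤ 2 ^ (Nat.size c + 1) * S := Nat.mul_le_mul_left _ hS
    refine ⟨_, .const s d c, ?_, ?_⟩
    · simp only [Cmd.len]
      nlinarith [Nat.zero_le (Nat.size c * (2 ^ (Nat.size c + 1) * S))]
    · refine (hs.mono ?_).setReg (by simp only [Cmd.len]; omega)
      exact Nat.le_mul_of_pos_left _ (by positivity)
  -- A product may double the bit length; this is the reason for the factor `2 ^ P.len`.
  | mul d a b =>
    refine ⟨_, .mul s d a b, ?_, ?_⟩
    · have := hs.1 a; have := hs.1 b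
      simp only [Cmd.len]; omega
    · exact (hs.mono (by simp only [Cmd.len]; omega)).setReg
        ((size_mul_le (hs.1 a) (hs.1 b)).trans (by simp only [Cmd.len]; omega))
  | add d a b =>
    refine exec_eval_of_atom hs rfl rfl rfl (fun h => ?_) hS
    have := hs.1 a; have := hs.1 b
    cases h; omega
  | sub d a b =>
    refine exec_eval_of_atom hs rfl rfl rfl (fun h => ?_) hS
    have := hs.1 a; have := hs.1 b
    cases h; omega
  | div d a b =>
    refine exec_eval_of_atom hs rfl rfl rfl (fun h => ?_) hS
    have := hs.1 a; have := hs.1 b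
    cases h; omega
  | load d a =>
    refine exec_eval_of_atom hs rfl rfl rfl (fun h => ?_) hS
    have := hs.1 a; have := hs.2 (s.reg a)
    cases h; omega
  | store a b =>
    refine exec_eval_of_atom hs rfl rfl rfl (fun h => ?_) hS
    have := hs.1 a; have := hs.1 b
    cases h; omega
  | seq P Q ihP ihQ =>
    simp only [Cmd.loopFree, Bool.and_eq_true] at hl
    have hS' : 1 ≤ 2 ^ P.len * S := Nat.mul_pos (by positivity) hS
    obtain ⟨t, h1, h2, h3⟩ := ihP hl.1 hS hs
    obtain ⟨t', h4, h5, h6⟩ := ihQ hl.2 hS' h3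
    have h7 : 2 ^ Q.len * (2 ^ P.len * S) = 2 ^ (P.len + Q.len) * S := by ring
    rw [h7] at h5 h6
    refine ⟨_, h1.seq h4, ?_, h6⟩
    simp only [Cmd.len]
    have h8 : 2 ^ P.len * S ≤ 2 ^ (P.len + Q.len) * S :=
      Nat.mul_le_mul_right _ (Nat.pow_le_pow_right (by omega) (by omega))
    rw [add_mul]
    exact Nat.add_le_add (h2.trans (Nat.mul_le_mul_left _ (by omega))) h5
  | ite a P Q ihP ihQ =>
    simp only [Cmd.loopFree, Bool.and_eq_true] at hl
    have key : ∀ l ≤ P.len + Q.len, ∀ t ≤ l * (1 + 2 * (2 ^ l * S)),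
        1 + Nat.size (s.reg a) + t ≤ (P.len + Q.len + 1) *
          (1 + 2 * (2 ^ (P.len + Q.len + 1) * S)) ∧ 2 ^ l * S ≤ 2 ^ (P.len + Q.len + 1) * S := by
      intro l hl t ht
      have h8 : 2 ^ l * S ≤ 2 ^ (P.len + Q.len + 1) * S :=
        Nat.mul_le_mul_right _ (Nat.pow_le_pow_right (by omega) (by omega))
      have h9 : 1 * S ≤ 2 ^ (P.len + Q.len + 1) * S :=
        Nat.mul_le_mul_right _ (Nat.one_le_two_pow)
      have := hs.1 a
      have h10 := Nat.mul_le_mul hl (by omega : 1 + 2 * (2 ^ l * S) ≤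
        1 + 2 * (2 ^ (P.len + Q.len + 1) * S))
      rw [add_mul _ 1]
      omega
    simp only [Cmd.eval, Cmd.len]
    split_ifs with h
    · obtain ⟨t, h1, h2, h3⟩ := ihQ hl.2 hS hs
      obtain ⟨h4, h5⟩ := key _ (by omega) t h2
      exact ⟨_, h1.iteFalse h, h4, h3.mono h5⟩
    · obtain ⟨t, h1, h2, h3⟩ := ihP hl.1 hS hs
      obtain ⟨h4, h5⟩ := key _ (by omega) t h2
      exact ⟨_, h1.iteTrue h, h4, h3.mono h5⟩
  | loop a P => simp [Cmd.loopFree] at hl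

theorem size_getD_le_bitLength (w : List ℕ) (i : ℕ) : Nat.size (w.getD i 0) ≤ bitLength w := by
  induction w generalizing i with
  | nil => simp
  | cons x w ih =>
    cases i with
    | zero => simp [bitLength]; omega
    | succ i =>
      have := ih i
      simp [bitLength] at this ⊢
      omega

theorem bounded_init (w : List ℕ) : Bounded (bitLength w) (init w) :=
  ⟨fun r => by simp [init], fun i => size_getD_le_bitLength w i⟩

theorem length_le_bitLength (w : List ℕ) : w.length ≤ bitLength w := by
  induction w with
  | nil => simp
  | cons x w ih => simp [bitLength] at ih ⊢; omega

end RAM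

/-! ### The scheduling program -/

namespace RAM

open Finset

namespace Cmd

/-- One step of `machineLoad`. -/
def machineLoadStep : Cmd :=
  .seq (.sub 12 12 7) <| .seq (.add 14 5 12) <| .seq (.load 14 14) <| .seq (.sub 15 14 11) <|
  .seq (.sub 16 11 14) <| .seq (.add 15 15 16) <|
  .ite 15 (.const 15 0) <| .seq (.add 14 3 12) <| .seq (.load 14 14) <|
  .ite 14 (.add 13 13 2) (.add 13 13 7)

/-- Compute the load of machine `r_11` in `r_13`. -/
def machineLoad : Cmd :=
  .seq (.seq (.const 13 0) <| .seq (.const 14 0) (.add 12 0 14)) (.loop 12 machineLoadStep)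

/-- The part of `findMachineStep` after the computation of the load. -/
def checkMachine : Cmd :=
  .seq (.sub 14 8 13) <|
  .seq (.ite 14
    (.seq (.add 15 6 11) <| .seq (.load 15 15) <| .seq (.sub 15 15 1) <|
      .ite 15 (.const 15 0) (.add 10 11 15))
    (.const 14 0)) <|
  .sub 11 11 7

/-- One step of `findMachine`. -/
def findMachineStep : Cmd :=
  .seq machineLoad checkMachine

/-- Search a machine of load less than the threshold and label at most `m`; the result is in
`r_10`, which is `0` if there is none. -/
def findMachine : Cmd :=
  .seq (.seq (.const 10 0) (.add 11 1 10)) (.loop 11 findMachineStep)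

/-- One step of `findJob`. -/
def findJobStep : Cmd :=
  .seq (.sub 12 12 7) <| .seq (.sub 14 14 1) <| .seq (.load 15 14) <|
  .ite 15
    (.seq (.add 16 5 12) <| .seq (.load 16 16) <| .seq (.add 16 6 16) <| .seq (.load 16 16) <|
      .seq (.sub 16 17 16) <| .ite 16 (.add 13 12 7) (.const 16 0))
    (.const 15 0)

/-- Search a job that may move to machine `r_10` from a machine of smaller label; its index plus
one is the result in `r_13`, which is `0` if there is none. -/
def findJob : Cmd :=
  .seq (.seq (.add 14 5 10) <| .seq (.sub 14 14 7) <| .seq (.add 17 6 10) <| .seq (.load 17 17) <|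
    .seq (.const 13 0) <| .seq (.const 15 0) (.add 12 0 15)) (.loop 12 findJobStep)

/-- Move job `r_13 - 1` to machine `r_10`. -/
def moveJob : Cmd :=
  .seq (.sub 13 13 7) <| .seq (.add 13 5 13) <| .seq (.load 14 13) <| .seq (.sub 14 7 14) <|
  .seq (.sub 9 9 14) (.store 13 10)

/-- Raise the label of machine `r_10`. -/
def relabel : Cmd :=
  .seq (.add 17 17 7) <| .seq (.add 16 6 10) (.store 16 17)

/-- One step of the pull-relabel process. -/
def pullStep : Cmd :=
  .seq findMachine <| .ite 10 (.seq findJob (.ite 13 moveJob relabel)) (.add 8 8 7)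

/-- One step of `output`. -/
def outputStep : Cmd :=
  .seq (.sub 12 12 7) <| .seq (.add 14 5 12) <| .seq (.load 14 14) <| .seq (.sub 14 14 7)
  (.store 12 14)

/-- Write the schedule to the cells `0, 1, …`. -/
def output : Cmd :=
  .seq (.seq (.const 14 0) (.add 12 0 14)) (.loop 12 outputStep)

/-- The pull-relabel process and its output. -/
def schedule : Cmd :=
  .seq (.loop 9 pullStep) output

end Cmd

/-! ### Correctness and cost of the subroutines -/

theorem eval_machineLoadStep {s : State} {n : ℕ} (h1 : s.reg 7 = 1) (hn : s.reg 12 = n + 1) :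
    (Cmd.machineLoadStep.eval s).reg 12 = n ∧
    (Cmd.machineLoadStep.eval s).reg 13 = s.reg 13 +
      if s.mem (s.reg 5 + n) = s.reg 11 then (if s.mem (s.reg 3 + n) = 0 then 1 else s.reg 2)
      else 0 := by
  by_cases h2 : s.mem (s.reg 5 + n) = s.reg 11
  · by_cases h3 : s.mem (s.reg 3 + n) = 0
    · simp [Cmd.machineLoadStep, Cmd.eval, State.setReg, h1, hn, h2, h3]
    · simp [Cmd.machineLoadStep, Cmd.eval, State.setReg, h1, hn, h2, h3]
  · have h3 : ¬ (s.mem (s.reg 5 + n) ≤ s.reg 11 ∧ s.reg 11 ≤ s.mem (s.reg 5 + n)) := by omega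
    simp [Cmd.machineLoadStep, Cmd.eval, State.setReg, h1, hn, h2, Nat.sub_eq_zero_iff_le, h3]

/-- The counter runs downwards, so the load found so far plus the sum over the jobs still below the
counter is constant. Equality of two numbers is tested by adding both truncated differences. -/
theorem exists_runs_machineLoad {s : State} (h1 : s.reg 7 = 1) :
    ∃ s', Runs .machineLoad s s' (30 * (s.reg 0 + 1)) ∧
      s'.reg 13 = PullRelabel.load (s.reg 0)
        (fun j => if s.mem (s.reg 3 + j) = 0 then 1 else s.reg 2)
        (fun j => s.mem (s.reg 5 + j)) (s.reg 11) := by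
  set f : ℕ → ℕ := fun j => if s.mem (s.reg 5 + j) = s.reg 11 then
    (if s.mem (s.reg 3 + j) = 0 then 1 else s.reg 2) else 0 with hf
  set I : Cmd := .seq (.const 13 0) <| .seq (.const 14 0) (.add 12 0 14) with hI
  have hR := runs_eval (P := I) rfl rfl s
  obtain ⟨e1, e2, e3⟩ : (I.eval s).reg 13 = 0 ∧ (I.eval s).reg 12 = s.reg 0 ∧
      (I.eval s).mem = s.mem := by simp [hI, Cmd.eval, State.setReg]
  have er : ∀ r < 12, (I.eval s).reg r = s.reg r := fun r hr => hR.reg_eq (b := 12) rfl hr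
  obtain ⟨s', h2, h3, h4, h5, h6⟩ := exists_runs_loop_frame (a := 12)
    (b := Cmd.machineLoadStep.len) (c := 12) (P := .machineLoadStep) rfl rfl
    (fun t => t.reg 13 + ∑ j ∈ range (t.reg 12), f j = ∑ j ∈ range (s.reg 0), f j)
    (fun t => t.reg 12) (I.eval s) (fun t hm hr hi ha => by
      obtain ⟨n, hn⟩ := Nat.exists_eq_succ_of_ne_zero ha
      obtain ⟨h3, h4⟩ := eval_machineLoadStep (s := t) (by rw [hr 7 (by omega), er 7 (by omega), h1]) hn
      refine ⟨_, runs_eval rfl rfl t, ?_, by omega⟩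
      rw [h3, h4, ← hi, hn, sum_range_succ, hm, e3, hr 5 (by omega), hr 11 (by omega),
        hr 3 (by omega), hr 2 (by omega), er 5 (by omega), er 11 (by omega), er 3 (by omega),
        er 2 (by omega)]
      ring) (by rw [e1, e2, zero_add])
  refine ⟨s', (hR.seq h2).mono ?_, ?_⟩
  · rw [e2]
    simp [hI, Cmd.len, Cmd.machineLoadStep]
    omega
  · have h7 : s'.reg 13 = ∑ j ∈ range (s.reg 0), f j := by simpa [h6] using h5
    exact h7

theorem eval_checkMachine (s : State) (h1 : s.reg 7 = 1) :
    (Cmd.checkMachine.eval s).reg 11 = s.reg 11 - 1 ∧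
    (Cmd.checkMachine.eval s).reg 10 =
      if s.reg 13 < s.reg 8 ∧ s.mem (s.reg 6 + s.reg 11) ≤ s.reg 1 then s.reg 11
      else s.reg 10 := by
  by_cases h2 : s.reg 13 < s.reg 8
  · have h4 : ¬ s.reg 8 ≤ s.reg 13 := by omega
    by_cases h3 : s.mem (s.reg 6 + s.reg 11) ≤ s.reg 1
    · simp [Cmd.checkMachine, Cmd.eval, State.setReg, h1, h2, h3, h4, Nat.sub_eq_zero_iff_le]
    · simp [Cmd.checkMachine, Cmd.eval, State.setReg, h1, h2, h3, h4, Nat.sub_eq_zero_iff_le]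
  · have h4 : s.reg 8 ≤ s.reg 13 := by omega
    simp [Cmd.checkMachine, Cmd.eval, State.setReg, h1, h2, h4]

/-- The search has no early exit: each suitable machine overwrites the previous one in `r_10`, so
any nonzero result is suitable, and `0` means that all machines failed. -/
theorem exists_runs_findMachine {s : State} (h1 : s.reg 7 = 1) {L d : ℕ → ℕ}
    (hL : ∀ v, L v = PullRelabel.load (s.reg 0)
        (fun j => if s.mem (s.reg 3 + j) = 0 then 1 else s.reg 2)
        (fun j => s.mem (s.reg 5 + j)) v) (hd : ∀ v, d v = s.mem (s.reg 6 + v)) :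
    ∃ s', Runs .findMachine s s' (60 * (s.reg 1 + 1) * (s.reg 0 + 1)) ∧
      ((s'.reg 10 = 0 ∧ ∀ v, 1 ≤ v → v ≤ s.reg 1 → s.reg 8 ≤ L v ∨ s.reg 1 < d v) ∨
        (1 ≤ s'.reg 10 ∧ s'.reg 10 ≤ s.reg 1 ∧ L (s'.reg 10) < s.reg 8 ∧
          d (s'.reg 10) ≤ s.reg 1)) := by
  set I : Cmd := .seq (.const 10 0) (.add 11 1 10) with hI
  have hR := runs_eval (P := I) rfl rfl s
  obtain ⟨e1, e2, e3⟩ : (I.eval s).reg 10 = 0 ∧ (I.eval s).reg 11 = s.reg 1 ∧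
      (I.eval s).mem = s.mem := by simp [hI, Cmd.eval, State.setReg]
  have er : ∀ r < 10, (I.eval s).reg r = s.reg r := fun r hr => hR.reg_eq (b := 10) rfl hr
  obtain ⟨s', h2, h3, h4, h5, h6⟩ := exists_runs_loop_frame (a := 11)
    (b := 30 * (s.reg 0 + 1) + Cmd.checkMachine.len) (c := 10) (P := .findMachineStep) rfl rfl
    (fun t => t.reg 11 ≤ s.reg 1 ∧
      ((t.reg 10 = 0 ∧ ∀ v, t.reg 11 < v → v ≤ s.reg 1 → s.reg 8 ≤ L v ∨ s.reg 1 < d v) ∨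
        (1 ≤ t.reg 10 ∧ t.reg 10 ≤ s.reg 1 ∧ L (t.reg 10) < s.reg 8 ∧
          d (t.reg 10) ≤ s.reg 1)))
    (fun t => t.reg 11) (I.eval s) (fun t hm hr hi ha => by
      have hr' : ∀ r < 10, t.reg r = s.reg r := fun r h => (hr r h).trans (er r h)
      rw [e3] at hm
      obtain ⟨u, h3, h4⟩ := exists_runs_machineLoad (s := t) (by rw [hr' 7 (by omega), h1])
      have hu : ∀ r < 12, u.reg r = t.reg r := fun r h => h3.reg_eq (b := 12) rfl h
      have hum : u.mem = s.mem := (h3.mem_eq rfl).trans hm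
      rw [hr' 0 (by omega), hr' 2 (by omega), hr' 3 (by omega), hr' 5 (by omega), hm, ← hL] at h4
      have hu7 : u.reg 7 = 1 := by rw [hu 7 (by omega), hr' 7 (by omega), h1]
      obtain ⟨h7, h8⟩ := eval_checkMachine u hu7
      rw [h4, hum, hu 1 (by omega), hu 6 (by omega), hu 8 (by omega), hu 10 (by omega),
        hu 11 (by omega), hr' 1 (by omega), hr' 6 (by omega), hr' 8 (by omega), ← hd] at h8
      rw [hu 11 (by omega)] at h7
      refine ⟨_, (h3.seq (runs_eval rfl rfl u)).mono ?_, ?_, by omega⟩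
      · rw [hr' 0 (by omega)]
      · rw [h7, h8]
        refine ⟨by omega, ?_⟩
        split_ifs with hc
        · exact Or.inr ⟨by omega, hi.1, hc⟩
        · rcases hi.2 with ⟨h9, h10⟩ | h9
          · refine Or.inl ⟨h9, fun v hv1 hv2 => ?_⟩
            rcases eq_or_ne v (t.reg 11) with rfl | hne
            · by_contra! hcon
              exact hc ⟨hcon.1, hcon.2⟩
            · exact h10 v (by omega) hv2
          · exact Or.inr h9)
    ⟨e2.le, Or.inl ⟨e1, fun v hv1 hv2 => by omega⟩⟩
  refine ⟨s', (hR.seq h2).mono ?_, ?_⟩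
  · rw [e2]
    simp [hI, Cmd.len, Cmd.checkMachine]
    nlinarith [Nat.zero_le (s.reg 0 * s.reg 1)]
  · rw [h6] at h5
    simpa [Nat.one_le_iff_ne_zero, Nat.pos_iff_ne_zero] using h5.2

theorem eval_findJobStep {s : State} {n : ℕ} (h1 : s.reg 7 = 1) (hn : s.reg 12 = n + 1) :
    (Cmd.findJobStep.eval s).reg 12 = n ∧
    (Cmd.findJobStep.eval s).reg 14 = s.reg 14 - s.reg 1 ∧
    (Cmd.findJobStep.eval s).reg 17 = s.reg 17 ∧
    (Cmd.findJobStep.eval s).reg 13 =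
      if s.mem (s.reg 14 - s.reg 1) ≠ 0 ∧
        s.mem (s.reg 6 + s.mem (s.reg 5 + n)) < s.reg 17 then n + 1 else s.reg 13 := by
  by_cases h2 : s.mem (s.reg 14 - s.reg 1) = 0
  · simp [Cmd.findJobStep, Cmd.eval, State.setReg, h1, hn, h2]
  · by_cases h3 : s.mem (s.reg 6 + s.mem (s.reg 5 + n)) < s.reg 17
    · have h4 : ¬ s.reg 17 ≤ s.mem (s.reg 6 + s.mem (s.reg 5 + n)) := by omega
      simp [Cmd.findJobStep, Cmd.eval, State.setReg, h1, hn, h2, h3, h4, Nat.sub_eq_zero_iff_le]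
    · have h4 : s.reg 17 ≤ s.mem (s.reg 6 + s.mem (s.reg 5 + n)) := by omega
      simp [Cmd.findJobStep, Cmd.eval, State.setReg, h1, hn, h2, h4]

/-- `a` is the address of the incidence matrix. The pointer `r_14` starts one row past its end, in
the column of the machine, and moves back by `m` cells per job, which avoids multiplication. -/
theorem exists_runs_findJob {s : State} (h1 : s.reg 7 = 1) {a : ℕ}
    (ha : s.reg 5 = a + s.reg 0 * s.reg 1) (hv : 1 ≤ s.reg 10) :
    ∃ s', Runs .findJob s s' (30 * (s.reg 0 + 1)) ∧
      s'.reg 17 = s.mem (s.reg 6 + s.reg 10) ∧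
      ((s'.reg 13 = 0 ∧ ∀ j < s.reg 0, s.mem (a + j * s.reg 1 + (s.reg 10 - 1)) ≠ 0 →
          s.mem (s.reg 6 + s.reg 10) ≤ s.mem (s.reg 6 + s.mem (s.reg 5 + j))) ∨
        ∃ j < s.reg 0, s'.reg 13 = j + 1 ∧ s.mem (a + j * s.reg 1 + (s.reg 10 - 1)) ≠ 0 ∧
          s.mem (s.reg 6 + s.mem (s.reg 5 + j)) < s.mem (s.reg 6 + s.reg 10)) := by
  set I : Cmd := .seq (.add 14 5 10) <| .seq (.sub 14 14 7) <| .seq (.add 17 6 10) <|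
    .seq (.load 17 17) <| .seq (.const 13 0) <| .seq (.const 15 0) (.add 12 0 15) with hI
  have hR := runs_eval (P := I) rfl rfl s
  obtain ⟨e1, e2, e3, e4, e5⟩ : (I.eval s).reg 13 = 0 ∧ (I.eval s).reg 12 = s.reg 0 ∧
      (I.eval s).mem = s.mem ∧ (I.eval s).reg 14 = s.reg 5 + s.reg 10 - 1 ∧
      (I.eval s).reg 17 = s.mem (s.reg 6 + s.reg 10) := by
    simp [hI, Cmd.eval, State.setReg, h1]
  have er : ∀ r < 12, (I.eval s).reg r = s.reg r := fun r hr => hR.reg_eq (b := 12) rfl hr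
  obtain ⟨s', h2, h3, h4, h5, h6⟩ := exists_runs_loop_frame (a := 12)
    (b := Cmd.findJobStep.len) (c := 12) (P := .findJobStep) rfl rfl
    (fun t => t.reg 12 ≤ s.reg 0 ∧ t.reg 14 = a + t.reg 12 * s.reg 1 + (s.reg 10 - 1) ∧
      t.reg 17 = s.mem (s.reg 6 + s.reg 10) ∧
      ((t.reg 13 = 0 ∧ ∀ j < s.reg 0, t.reg 12 ≤ j →
          s.mem (a + j * s.reg 1 + (s.reg 10 - 1)) ≠ 0 →
          s.mem (s.reg 6 + s.reg 10) ≤ s.mem (s.reg 6 + s.mem (s.reg 5 + j))) ∨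
        ∃ j < s.reg 0, t.reg 13 = j + 1 ∧ s.mem (a + j * s.reg 1 + (s.reg 10 - 1)) ≠ 0 ∧
          s.mem (s.reg 6 + s.mem (s.reg 5 + j)) < s.mem (s.reg 6 + s.reg 10)))
    (fun t => t.reg 12) (I.eval s) (fun t hm hr hi ha' => by
      have hr' : ∀ r < 12, t.reg r = s.reg r := fun r h => (hr r h).trans (er r h)
      rw [e3] at hm
      obtain ⟨i1, i2, i3, i4⟩ := hi
      obtain ⟨n, hn⟩ := Nat.exists_eq_succ_of_ne_zero ha'
      obtain ⟨h3, h4, h5, h6⟩ := eval_findJobStep (s := t) (by rw [hr' 7 (by omega), h1]) hn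
      have hptr : t.reg 14 - t.reg 1 = a + n * s.reg 1 + (s.reg 10 - 1) := by
        rw [i2, hn, Nat.succ_mul, hr' 1 (by omega)]
        omega
      rw [hptr, hm, hr' 6 (by omega), hr' 5 (by omega), i3] at h6
      refine ⟨_, runs_eval rfl rfl t, ?_, by omega⟩
      rw [h3, h4, h5, h6, hptr]
      refine ⟨by omega, rfl, i3, ?_⟩
      split_ifs with hc
      · exact Or.inr ⟨n, by omega, rfl, hc⟩
      · rcases i4 with ⟨h9, h10⟩ | h9
        · refine Or.inl ⟨h9, fun j hj1 hj2 hj3 => ?_⟩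
          rcases eq_or_ne j n with rfl | hne
          · by_contra! hcon
            exact hc ⟨hj3, hcon⟩
          · exact h10 j hj1 (by omega) hj3
        · exact Or.inr h9)
    ⟨e2.le, by rw [e4, e2, ha]; omega, e5, Or.inl ⟨e1, fun j hj1 hj2 => by omega⟩⟩
  refine ⟨s', (hR.seq h2).mono ?_, h5.2.2.1, ?_⟩
  · rw [e2]
    simp [hI, Cmd.len, Cmd.findJobStep]
    omega
  · simpa [h6] using h5.2.2.2

/-- By truncation, `r_9` drops by one exactly when the job was unassigned and `r_9` is positive. -/
theorem eval_moveJob {s : State} {j : ℕ} (h1 : s.reg 7 = 1) (hj : s.reg 13 = j + 1) :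
    (Cmd.moveJob.eval s).mem = Function.update s.mem (s.reg 5 + j) (s.reg 10) ∧
    (Cmd.moveJob.eval s).reg 9 = s.reg 9 - (1 - s.mem (s.reg 5 + j)) := by
  simp [Cmd.moveJob, Cmd.eval, State.setReg, State.setMem, h1, hj]

theorem eval_relabel {s : State} (h1 : s.reg 7 = 1) :
    (Cmd.relabel.eval s).mem = Function.update s.mem (s.reg 6 + s.reg 10) (s.reg 17 + 1) := by
  simp [Cmd.relabel, Cmd.eval, State.setReg, State.setMem, h1]

end RAM

/-! ### Correctness and running time of the main loop -/

namespace RAM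

open Finset

/-- The part of the input of the scheduling problem that the program reads: for `j < N` and
`1 ≤ v ≤ m` the cell `c + j` tells whether job `j` is big, and `c + N + j * m + (v - 1)` whether
job `j` may be scheduled on machine `v`. -/
structure IsInput (N m k c : ℕ) (mem₀ : ℕ → ℕ) (p : ℕ → ℕ) (A : ℕ → ℕ → Prop) : Prop where
  size : ∀ j < N, p j = if mem₀ (c + j) = 0 then 1 else k
  adm : ∀ j < N, ∀ v, 1 ≤ v → v ≤ m → (A j v ↔ mem₀ (c + N + j * m + (v - 1)) ≠ 0)
  pos : 0 < k

/-- The invariant of the main loop; `b` is the address of the schedule. -/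
structure LoopInv (N m k c b : ℕ) (mem₀ : ℕ → ℕ) (p : ℕ → ℕ) (A : ℕ → ℕ → Prop)
    (s : State) : Prop where
  r0 : s.reg 0 = N
  r1 : s.reg 1 = m
  r2 : s.reg 2 = k
  r3 : s.reg 3 = c
  r5 : s.reg 5 = b
  r6 : s.reg 6 = b + N
  r7 : s.reg 7 = 1
  mem : ∀ x < b, s.mem x = mem₀ x
  inv : PullRelabel.Inv N m p A (fun j => s.mem (b + j)) (fun v => s.mem (b + N + v)) (s.reg 8)
  card : s.reg 9 = #{j ∈ range N | s.mem (b + j) = 0}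

theorem card_filter_update {N i w : ℕ} {σ : ℕ → ℕ} (hi : i < N) (hw : 1 ≤ w) :
    #{j ∈ range N | Function.update σ i w j = 0} = #{j ∈ range N | σ j = 0} - (1 - σ i) := by
  have h : ({j ∈ range N | Function.update σ i w j = 0} : Finset ℕ) =
      ({j ∈ range N | σ j = 0} : Finset ℕ).erase i := by
    ext j
    rcases eq_or_ne j i with rfl | hj
    · simp; omega
    · simp [hj]
  rw [h, card_erase_eq_ite]
  split_ifs with h'
  · rw [(mem_filter.1 h').2]
  · have : σ i ≠ 0 := fun h0 => h' (by simp [hi, h0])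
    omega

/-- The three branches of the program are `Inv.raise`, `Inv.relabel` and `Inv.move`. The schedule
occupies the cells `b + j` with `j < N` and the labels start at `b + N`, so neither kind of write
disturbs the other table. -/
theorem exists_runs_pullStep {N m k c b : ℕ} {mem₀ p : ℕ → ℕ} {A : ℕ → ℕ → Prop}
    (hI : IsInput N m k c mem₀ p A) (hb : b = c + N + N * m) {s : State}
    (H : LoopInv N m k c b mem₀ p A s) (h9 : s.reg 9 ≠ 0) :
    ∃ s', Runs .pullStep s s' (120 * (m + 1) * (N + 1)) ∧ LoopInv N m k c b mem₀ p A s' ∧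
      PullRelabel.potential N m (fun j => s.mem (b + j)) (fun v => s.mem (b + N + v)) (s.reg 8) <
      PullRelabel.potential N m (fun j => s'.mem (b + j)) (fun v => s'.mem (b + N + v))
        (s'.reg 8) := by
  have hload : ∀ v, PullRelabel.load N p (fun j => s.mem (b + j)) v = PullRelabel.load (s.reg 0)
        (fun j => if s.mem (s.reg 3 + j) = 0 then 1 else s.reg 2)
        (fun j => s.mem (s.reg 5 + j)) v := fun v => by
    unfold PullRelabel.load
    rw [H.r0, H.r2, H.r3, H.r5]
    refine sum_congr rfl fun j hj => ?_
    rw [mem_range] at hj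
    rw [hI.size j hj, ← H.mem (c + j) (by rw [hb]; omega)]
  have hbit : ∀ j < N, ∀ v, 1 ≤ v → v ≤ m → (s.mem (c + N + j * m + (v - 1)) ≠ 0 ↔ A j v) :=
    fun j hj v h1 h2 => by
      have : (j + 1) * m ≤ N * m := Nat.mul_le_mul_right m hj
      rw [add_mul] at this
      rw [H.mem _ (by omega), hI.adm j hj v h1 h2]
  have hcost : 1 ≤ (m + 1) * (N + 1) := Nat.mul_pos (by omega) (by omega)
  have hcost' : N + 1 ≤ (m + 1) * (N + 1) := Nat.le_mul_of_pos_left _ (by omega)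
  obtain ⟨s₁, hr₁, h₁⟩ := exists_runs_findMachine H.r7 hload (d := fun v => s.mem (b + N + v))
    (fun v => by rw [H.r6])
  rw [H.r0, H.r1] at hr₁
  rw [H.r1] at h₁
  have e₁ : ∀ r < 10, s₁.reg r = s.reg r := fun r hr => hr₁.reg_eq (b := 10) rfl hr
  have m₁ : s₁.mem = s.mem := hr₁.mem_eq rfl
  rcases h₁ with ⟨h10, hsat⟩ | ⟨hw1, hwm, hwl, hwd⟩
  · -- raise the threshold
    have hr₂ := runs_eval (P := .add 8 8 7) rfl rfl s₁
    set s₂ := (Cmd.add 8 8 7).eval s₁ with hs₂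
    have e8 : s₂.reg 8 = s.reg 8 + 1 := by
      simp [hs₂, Cmd.eval, State.setReg, e₁, H.r7]
    have e9 : s₂.reg 9 = s.reg 9 := by
      simp [hs₂, Cmd.eval, State.setReg, e₁]
    have e₂ : ∀ r < 8, s₂.reg r = s.reg r := fun r hr =>
      (hr₂.reg_eq (b := 8) rfl hr).trans (e₁ r (by omega))
    have m₂ : s₂.mem = s.mem := (hr₂.mem_eq rfl).trans m₁
    obtain ⟨i, hi⟩ : ({j ∈ range N | s.mem (b + j) = 0} : Finset ℕ).Nonempty := by
      rw [← card_pos, ← H.card]; omega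
    rw [mem_filter, mem_range] at hi
    refine ⟨s₂, (hr₁.seq (Runs.iteFalse h10 hr₂)).mono ?_, ⟨by rw [e₂ 0 (by omega), H.r0],
      by rw [e₂ 1 (by omega), H.r1], by rw [e₂ 2 (by omega), H.r2], by rw [e₂ 3 (by omega), H.r3],
      by rw [e₂ 5 (by omega), H.r5], by rw [e₂ 6 (by omega), H.r6], by rw [e₂ 7 (by omega), H.r7],
      by rw [m₂]; exact H.mem, ?_, by rw [e9, m₂, H.card]⟩, ?_⟩
    · simp only [Cmd.len]
      nlinarith
    · rw [m₂, e8]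
      refine H.inv.raise (fun j hj => ?_) hi.1 hi.2 hsat
      rw [hI.size j hj]
      split_ifs
      · exact one_pos
      · exact hI.pos
    · rw [m₂, e8]
      unfold PullRelabel.potential
      omega
  · obtain ⟨s₂, hr₂, h17, h13⟩ := exists_runs_findJob (s := s₁) (a := c + N)
      (by rw [e₁ 7 (by omega), H.r7])
      (by rw [e₁ 5 (by omega), e₁ 0 (by omega), e₁ 1 (by omega), H.r5, H.r0, H.r1, hb]) hw1
    have e₂' : ∀ r < 12, s₂.reg r = s₁.reg r := fun r hr => hr₂.reg_eq (b := 12) rfl hr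
    have e₂ : ∀ r < 10, s₂.reg r = s.reg r := fun r hr =>
      (e₂' r (by omega)).trans (e₁ r (by omega))
    have m₂ : s₂.mem = s.mem := (hr₂.mem_eq rfl).trans m₁
    have h7 : s₂.reg 7 = 1 := by rw [e₂ 7 (by omega), H.r7]
    rw [m₁, e₁ 0 (by omega), e₁ 1 (by omega), e₁ 5 (by omega), e₁ 6 (by omega), H.r0, H.r1,
      H.r5, H.r6] at h13
    rw [m₁, e₁ 6 (by omega), H.r6] at h17
    rw [e₁ 0 (by omega), H.r0] at hr₂
    have hw : s₂.reg 10 = s₁.reg 10 := e₂' 10 (by omega)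
    set w := s₁.reg 10 with hw_def
    rcases h13 with ⟨h13, hno⟩ | ⟨j, hj, h13, hA, hd⟩
    · -- raise the label
      have hr₃ := runs_eval (P := .relabel) rfl rfl s₂
      have hm := eval_relabel h7
      set s₃ := Cmd.relabel.eval s₂ with hs₃
      rw [m₂, e₂ 6 (by omega), H.r6, hw, h17] at hm
      have e₃ : ∀ r < 10, s₃.reg r = s.reg r := fun r hr =>
        (hr₃.reg_eq (b := 10) rfl hr).trans (e₂ r hr)
      have hσ : ∀ j < N, s₃.mem (b + j) = s.mem (b + j) := fun j hj => by
        rw [hm, Function.update_of_ne (by omega)]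
      have hdd : (fun v => s₃.mem (b + N + v)) =
          Function.update (fun v => s.mem (b + N + v)) w (s.mem (b + N + w) + 1) := by
        ext v
        rw [hm]
        rcases eq_or_ne v w with rfl | hv
        · simp
        · rw [Function.update_of_ne (by omega), Function.update_of_ne hv]
      refine ⟨s₃, (hr₁.seq (Runs.iteTrue (by omega)
        (hr₂.seq (Runs.iteFalse h13 hr₃)))).mono ?_, ⟨by rw [e₃ 0 (by omega), H.r0],
        by rw [e₃ 1 (by omega), H.r1], by rw [e₃ 2 (by omega), H.r2],
        by rw [e₃ 3 (by omega), H.r3], by rw [e₃ 5 (by omega), H.r5],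
        by rw [e₃ 6 (by omega), H.r6], by rw [e₃ 7 (by omega), H.r7], fun x hx => ?_, ?_, ?_⟩, ?_⟩
      · simp only [Cmd.len, Cmd.relabel]
        nlinarith
      · rw [hm, Function.update_of_ne (by omega)]
        exact H.mem x hx
      · rw [hdd, e₃ 8 (by omega)]
        refine (H.inv.relabel hw1 hwd fun j hj hAj => ?_).congr hσ
        exact hno j hj ((hbit j hj w hw1 hwm).2 hAj)
      · rw [e₃ 9 (by omega), H.card]
        congr 1
        exact filter_congr fun j hj => by rw [hσ j (mem_range.1 hj)]
      · rw [hdd, e₃ 8 (by omega), PullRelabel.potential_congr hσ]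
        exact PullRelabel.potential_relabel hwm
    · -- move the job
      have hr₃ := runs_eval (P := .moveJob) rfl rfl s₂
      obtain ⟨hm, h9'⟩ := eval_moveJob h7 h13
      set s₃ := Cmd.moveJob.eval s₂ with hs₃
      rw [m₂, e₂ 5 (by omega), H.r5, hw] at hm
      rw [m₂, e₂ 5 (by omega), H.r5, e₂ 9 (by omega)] at h9'
      have e₃ : ∀ r < 9, s₃.reg r = s.reg r := fun r hr =>
        (hr₃.reg_eq (b := 9) rfl hr).trans (e₂ r (by omega))
      have hσ : (fun j => s₃.mem (b + j)) = Function.update (fun j => s.mem (b + j)) j w := by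
        ext i
        rw [hm]
        rcases eq_or_ne i j with rfl | hi
        · simp
        · rw [Function.update_of_ne (by omega), Function.update_of_ne hi]
      have hdd : (fun v => s₃.mem (b + N + v)) = fun v => s.mem (b + N + v) := by
        ext v
        rw [hm, Function.update_of_ne (by omega)]
      refine ⟨s₃, (hr₁.seq (Runs.iteTrue (by omega)
        (hr₂.seq (Runs.iteTrue (by omega) hr₃)))).mono ?_, ⟨by rw [e₃ 0 (by omega), H.r0],
        by rw [e₃ 1 (by omega), H.r1], by rw [e₃ 2 (by omega), H.r2],
        by rw [e₃ 3 (by omega), H.r3], by rw [e₃ 5 (by omega), H.r5],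
        by rw [e₃ 6 (by omega), H.r6], by rw [e₃ 7 (by omega), H.r7], fun x hx => ?_, ?_, ?_⟩, ?_⟩
      · simp only [Cmd.len, Cmd.moveJob]
        nlinarith
      · rw [hm, Function.update_of_ne (by omega)]
        exact H.mem x hx
      · rw [hdd, hσ, e₃ 8 (by omega)]
        exact H.inv.move hj hwm ((hbit j hj w hw1 hwm).1 hA) hwl hd
      · rw [h9', H.card, ← card_filter_update (σ := fun j => s.mem (b + j)) hj hw1, ← hσ]
      · rw [hdd, hσ, e₃ 8 (by omega)]
        exact PullRelabel.potential_move (d := fun v => s.mem (b + N + v)) hj hd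

/-- The main loop assigns all jobs. -/
theorem exists_runs_loop_pullStep {N m k c b : ℕ} {mem₀ p : ℕ → ℕ} {A : ℕ → ℕ → Prop}
    (hI : IsInput N m k c mem₀ p A) (hb : b = c + N + N * m) {τ : ℕ → ℕ}
    (hτ : PullRelabel.IsSchedule N m A τ) (hkN : k ≤ N + 1) {s : State}
    (H : LoopInv N m k c b mem₀ p A s) :
    ∃ s', Runs (.loop 9 .pullStep) s s'
        (if N = 0 then 1 else ((N + (m + 1)) * (m + 1) + N * (N + 1)) *
          (120 * (m + 1) * (N + 1) + 1) + 1) ∧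
      LoopInv N m k c b mem₀ p A s' ∧ ∀ j < N, s'.mem (b + j) ≠ 0 := by
  -- Here the cap on `k` makes the number of threshold steps polynomial.
  have hsum : ∑ j ∈ range N, p j ≤ N * (N + 1) := by
    refine (sum_le_card_nsmul _ _ (N + 1) fun j hj => ?_).trans (by simp)
    rw [hI.size j (mem_range.1 hj)]
    split_ifs <;> omega
  split_ifs with hN
  -- Without jobs the matrix is empty and `m` may be exponential in the input length, so it matters
  -- that the loop is never entered.
  · have h9 : s.reg 9 = 0 := by rw [H.card, hN]; simp
    exact ⟨s, Runs.loopDone h9, H, fun j hj => by omega⟩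
  obtain ⟨s', h1, h2, h3⟩ := exists_runs_loop (a := 9) (b := 120 * (m + 1) * (N + 1))
    (P := .pullStep) (LoopInv N m k c b mem₀ p A)
    (fun t => (N + (m + 1)) * (m + 1) + N * (N + 1) -
      PullRelabel.potential N m (fun j => t.mem (b + j)) (fun v => t.mem (b + N + v)) (t.reg 8))
    (fun t ht h9 => by
      obtain ⟨t', h1, h2, h3⟩ := exists_runs_pullStep hI hb ht h9
      refine ⟨t', h1, h2, ?_⟩
      have := h2.inv.potential_le hτ
      omega) s H
  refine ⟨s', h1.mono ?_, h2, fun j hj h0 => ?_⟩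
  · exact Nat.add_le_add_right (Nat.mul_le_mul_right _ (Nat.sub_le _ _)) 1
  · have h4 := h2.card
    rw [h3] at h4
    have h5 := card_eq_zero.1 h4.symm
    have h6 : j ∈ ({j ∈ range N | s'.mem (b + j) = 0} : Finset ℕ) := by simp [hj, h0]
    rw [h5] at h6
    simp at h6

theorem eval_outputStep {s : State} {n : ℕ} (h1 : s.reg 7 = 1) (hn : s.reg 12 = n + 1) :
    (Cmd.outputStep.eval s).reg 12 = n ∧
    (Cmd.outputStep.eval s).mem = Function.update s.mem n (s.mem (s.reg 5 + n) - 1) := by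
  simp [Cmd.outputStep, Cmd.eval, State.setReg, State.setMem, h1, hn]

/-- The output may overwrite the input, but only in cells below `N`; the schedule is read at
addresses from `r_5 ≥ N` on and stays intact. -/
theorem exists_runs_output {s : State} (h1 : s.reg 7 = 1) (h5 : s.reg 0 ≤ s.reg 5) :
    ∃ s', Runs .output s s' (20 * (s.reg 0 + 1)) ∧
      ∀ j < s.reg 0, s'.mem j = s.mem (s.reg 5 + j) - 1 := by
  set I : Cmd := .seq (.const 14 0) (.add 12 0 14) with hI
  have hR := runs_eval (P := I) rfl rfl s
  obtain ⟨e2, e3⟩ : (I.eval s).reg 12 = s.reg 0 ∧ (I.eval s).mem = s.mem := by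
    simp [hI, Cmd.eval, State.setReg]
  have er : ∀ r < 12, (I.eval s).reg r = s.reg r := fun r hr => hR.reg_eq (b := 12) rfl hr
  obtain ⟨s', h2, ⟨h3, h4, h6, h7, h8⟩, h9⟩ := exists_runs_loop (a := 12)
    (b := Cmd.outputStep.len) (P := .outputStep)
    (fun t => t.reg 7 = 1 ∧ t.reg 5 = s.reg 5 ∧ t.reg 12 ≤ s.reg 0 ∧
      (∀ x, s.reg 0 ≤ x → t.mem x = s.mem x) ∧
      ∀ j < s.reg 0, t.reg 12 ≤ j → t.mem j = s.mem (s.reg 5 + j) - 1)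
    (fun t => t.reg 12) (fun t ⟨h3, h4, h6, h7, h8⟩ ha => by
      obtain ⟨n, hn⟩ := Nat.exists_eq_succ_of_ne_zero ha
      have hr := runs_eval (P := .outputStep) rfl rfl t
      obtain ⟨h9, h10⟩ := eval_outputStep h3 hn
      have e : ∀ r < 12, (Cmd.outputStep.eval t).reg r = t.reg r := fun r h =>
        hr.reg_eq (b := 12) rfl h
      refine ⟨_, hr, ⟨by rw [e 7 (by omega), h3], by rw [e 5 (by omega), h4], by omega,
        fun x hx => ?_, fun j hj hj' => ?_⟩, by omega⟩
      · rw [h10, Function.update_of_ne (by omega), h7 x hx]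
      · rw [h10]
        rcases eq_or_ne j n with rfl | hne
        · rw [Function.update_self, h4, h7 _ (by omega)]
        · rw [Function.update_of_ne hne, h8 j hj (by omega)])
    (I.eval s) ⟨by rw [er 7 (by omega), h1], er 5 (by omega), e2.le, fun x _ => by rw [e3],
      fun j hj hj' => by omega⟩
  refine ⟨s', (hR.seq h2).mono ?_, fun j hj => h8 j hj (by omega)⟩
  rw [e2]
  simp [hI, Cmd.len, Cmd.outputStep]
  omega

/-- The program leaves the schedule in the cells `0, 1, …`; `L` bounds the number `N` of jobs and, if
there are any, the number `m` of machines. -/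
theorem exists_runs_schedule {N m k c b : ℕ} {mem₀ p : ℕ → ℕ} {A : ℕ → ℕ → Prop}
    (hI : IsInput N m k c mem₀ p A) (hb : b = c + N + N * m) {τ : ℕ → ℕ}
    (hτ : PullRelabel.IsSchedule N m A τ) (hkN : k ≤ N + 1) {s : State}
    (H : LoopInv N m k c b mem₀ p A s) {L : ℕ} (hNL : N ≤ L) (hmL : N ≠ 0 → m ≤ L) :
    ∃ s' σ d C, Runs .schedule s s' (1000 * (L + 1) ^ 4) ∧
      PullRelabel.Inv N m p A σ d C ∧ (∀ j < N, σ j ≠ 0) ∧ ∀ j < N, s'.mem j = σ j - 1 := by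
  obtain ⟨s₁, h1, h2, h3⟩ := exists_runs_loop_pullStep hI hb hτ hkN H
  obtain ⟨s₂, h4, h5⟩ := exists_runs_output h2.r7 (by rw [h2.r0, h2.r5, hb]; omega)
  rw [h2.r0] at h4 h5
  rw [h2.r5] at h5
  refine ⟨s₂, _, _, _, (h1.seq h4).mono ?_, h2.inv, h3, h5⟩
  have hp : ∀ i, 1 ≤ (L + 1) ^ i := fun i => Nat.one_le_pow _ _ (by omega)
  have hp4 := hp 4
  have hlin : 20 * (N + 1) ≤ 20 * (L + 1) ^ 4 := by
    have : (L + 1) ^ 1 ≤ (L + 1) ^ 4 := Nat.pow_le_pow_right (by omega) (by omega)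
    rw [pow_one] at this
    omega
  split_ifs with hN
  · omega
  · have hm := hmL hN
    have a1 : (N + (m + 1)) * (m + 1) + N * (N + 1) ≤ 3 * (L + 1) ^ 2 := by
      have i1 : (N + (m + 1)) * (m + 1) ≤ (L + (L + 1)) * (L + 1) := by gcongr
      have i2 : N * (N + 1) ≤ L * (L + 1) := by gcongr
      nlinarith
    have a2 : 120 * (m + 1) * (N + 1) + 1 ≤ 121 * (L + 1) ^ 2 := by
      have i1 : 120 * (m + 1) * (N + 1) ≤ 120 * (L + 1) * (L + 1) := by gcongr
      nlinarith
    have a3 := Nat.mul_le_mul a1 a2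
    have a4 : 3 * (L + 1) ^ 2 * (121 * (L + 1) ^ 2) = 363 * (L + 1) ^ 4 := by ring
    omega

end RAM

/-! ### Reading the input word -/

namespace RAM

open Finset

theorem getD_ofFn {n : ℕ} (f : Fin n → ℕ) {i : ℕ} (hi : i < n) :
    (List.ofFn f).getD i 0 = f ⟨i, hi⟩ := by
  rw [List.getD_eq_getElem _ _ (by simpa using hi), List.getElem_ofFn]

theorem getD_append_length_add (l l' : List ℕ) (i : ℕ) :
    (l ++ l').getD (l.length + i) 0 = l'.getD i 0 := by
  rw [List.getD_append_right _ _ _ _ (by omega), Nat.add_sub_cancel_left]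

theorem getD_flatten_ofFn {n m : ℕ} (f : Fin n → Fin m → ℕ) {j i : ℕ} (hj : j < n) (hi : i < m) :
    (List.ofFn fun j => List.ofFn (f j)).flatten.getD (j * m + i) 0 = f ⟨j, hj⟩ ⟨i, hi⟩ := by
  induction n generalizing j with
  | zero => omega
  | succ n ih =>
    rw [List.ofFn_succ, List.flatten_cons]
    cases j with
    | zero =>
      rw [List.getD_append _ _ _ _ (by simpa using hi), zero_mul, zero_add, getD_ofFn _ hi]
      rfl
    | succ j =>
      have h := getD_append_length_add (List.ofFn (f 0))
        (List.ofFn fun j : Fin n => List.ofFn (f j.succ)).flatten (j * m + i)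
      rw [List.length_ofFn] at h
      rw [show (j + 1) * m + i = m + (j * m + i) by ring, h, ih (fun j => f j.succ) (by omega)]
      rfl

end RAM

namespace TwoValuedInstance

variable (I : TwoValuedInstance)

theorem length_encode : I.encode.length = 2 + I.numJobs + I.numJobs * I.numMachines := by
  simp [encode, List.length_flatten, List.sum_ofFn]
  ring

theorem getD_encode_zero : I.encode.getD 0 0 = I.numJobs := by simp [encode]

theorem getD_encode_one : I.encode.getD 1 0 = I.numMachines := by simp [encode]

theorem getD_encode_big {j : ℕ} (hj : j < I.numJobs) :
    I.encode.getD (2 + j) 0 = (I.big ⟨j, hj⟩).toNat := by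
  have h := RAM.getD_append_length_add [I.numJobs, I.numMachines]
    (List.ofFn (fun j => (I.big j).toNat) ++
      (List.ofFn fun j => List.ofFn fun i => (I.allowed j i).toNat).flatten) j
  rw [encode, List.append_assoc]
  refine h.trans ?_
  rw [List.getD_append _ _ _ _ (by simpa using hj), RAM.getD_ofFn _ hj]

theorem getD_encode_allowed {j i : ℕ} (hj : j < I.numJobs) (hi : i < I.numMachines) :
    I.encode.getD (2 + I.numJobs + j * I.numMachines + i) 0 =
      (I.allowed ⟨j, hj⟩ ⟨i, hi⟩).toNat := by
  have h := RAM.getD_append_length_add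
    ([I.numJobs, I.numMachines] ++ List.ofFn (fun j => (I.big j).toNat))
    (List.ofFn fun j => List.ofFn fun i => (I.allowed j i).toNat).flatten
    (j * I.numMachines + i)
  rw [RAM.getD_flatten_ofFn _ hj hi] at h
  rw [encode, ← h]
  congr 1
  simp
  ring

theorem isInput {w : List ℕ} {c : ℕ} (hw : ∀ i, w.getD (c + i) 0 = I.encode.getD i 0) {k : ℕ}
    (hk : 0 < k) : RAM.IsInput I.numJobs I.numMachines k (c + 2) (RAM.init w).mem
      (I.roundedSize k) I.Adm where
  size j hj := by
    have h0 : (RAM.init w).mem (c + 2 + j) = (I.big ⟨j, hj⟩).toNat := by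
      rw [add_assoc, ← I.getD_encode_big hj, ← hw]
      rfl
    rw [h0]
    cases h : I.big ⟨j, hj⟩ <;> simp [roundedSize, hj, h]
  adm j hj v h1 h2 := by
    have hv : v - 1 < I.numMachines := by omega
    simp only [RAM.init]
    rw [show c + 2 + I.numJobs + j * I.numMachines + (v - 1) =
      c + (2 + I.numJobs + j * I.numMachines + (v - 1)) by ring, hw, I.getD_encode_allowed hj hv]
    simp [Adm, hj, hv]
  pos := hk

end TwoValuedInstance

/-! ### The prelude and the complete program -/

namespace RAM

/-- Given the address of the instance in `r_18` and the rounded size of big jobs in `r_2`, prepare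
the registers for the main loop. -/
def Cmd.setup : Cmd :=
  .seq (.load 0 18) <| .seq (.const 7 1) <| .seq (.add 19 18 7) <| .seq (.load 1 19) <|
  .seq (.add 3 19 7) <| .seq (.add 5 3 0) <| .seq (.mul 6 0 1) <| .seq (.add 5 5 6) <|
  .seq (.add 6 5 0) <| .seq (.add 20 0 7) <| .seq (.sub 20 2 20) <| .seq (.sub 2 2 20) <|
  .seq (.const 10 0) (.add 9 0 10)

/-- For a rational `α`, given by numerator and denominator in the cells `0` and `1`, compute the
rounded size of big jobs. -/
def Cmd.chooseRounding : Cmd :=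
  .seq (.const 21 0) <| .seq (.load 22 21) <| .seq (.const 21 1) <| .seq (.load 23 21) <|
  .seq (.const 18 2) <| .seq (.div 24 22 23) <| .seq (.add 25 22 23) <| .seq (.sub 25 25 21) <|
  .seq (.div 25 25 23) <| .seq (.sub 26 25 21) <| .seq (.mul 26 26 23) <| .seq (.mul 26 26 23) <|
  .seq (.mul 26 26 24) <| .seq (.sub 27 22 23) <| .seq (.mul 27 22 27) <| .seq (.sub 26 26 27) <|
  .seq (.const 27 0) <| .ite 26 (.add 2 24 27) (.add 2 25 27)

/-- The cells behind the input are zero, which already encodes the empty schedule with zero labels.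
The cap arises as `k - (k - (N + 1)) = min k (N + 1)`. -/
theorem eval_setup {s : State} (h8 : s.reg 8 = 0) {N m c k : ℕ} {mem₀ p : ℕ → ℕ}
    {A : ℕ → ℕ → Prop} (hmem : s.mem = mem₀) (hc : s.reg 18 = c) (hk : s.reg 2 = k)
    (hN : mem₀ c = N) (hm : mem₀ (c + 1) = m)
    (hz : ∀ i, c + 2 + N + N * m ≤ i → mem₀ i = 0) :
    LoopInv N m (min k (N + 1)) (c + 2) (c + 2 + N + N * m) mem₀ p A (Cmd.setup.eval s) := by
  subst hmem
  have e : (Cmd.setup.eval s).mem = s.mem := by simp [Cmd.setup, Cmd.eval, State.setReg]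
  constructor
  · simp [Cmd.setup, Cmd.eval, State.setReg, hc, hN]
  · simp [Cmd.setup, Cmd.eval, State.setReg, hc, hm]
  · simp [Cmd.setup, Cmd.eval, State.setReg, hc, hN, hk]
    omega
  · simp [Cmd.setup, Cmd.eval, State.setReg, hc]
  · simp [Cmd.setup, Cmd.eval, State.setReg, hc, hN, hm]
  · simp [Cmd.setup, Cmd.eval, State.setReg, hc, hN, hm]
  · simp [Cmd.setup, Cmd.eval, State.setReg]
  · intro x _
    rw [e]
  · have h1 : (fun j => (Cmd.setup.eval s).mem (c + 2 + N + N * m + j)) = fun _ => 0 := by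
      ext j
      rw [e, hz _ (by omega)]
    have h2 : (fun v => (Cmd.setup.eval s).mem (c + 2 + N + N * m + N + v)) = fun _ => 0 := by
      ext j
      rw [e, hz _ (by omega)]
    have h3 : (Cmd.setup.eval s).reg 8 = 0 := by simp [Cmd.setup, Cmd.eval, State.setReg, h8]
    rw [h1, h2, h3]
    exact PullRelabel.inv_zero
  · rw [Finset.filter_true_of_mem fun j _ => by rw [e, hz _ (by omega)], Finset.card_range]
    simp [Cmd.setup, Cmd.eval, State.setReg, hc, hN]

/-- A time bound for the scheduling program, preceded by a program of length `l` without loops. -/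
noncomputable def timeBound (l : ℕ) : Polynomial ℕ :=
  .C l * (1 + 2 * (.C (2 ^ l) * .X)) +
    1000 * (.X + 1) ^ 4 * (3 + 2 * (.C (2 ^ l) * .X + 1000 * (.X + 1) ^ 4))

end RAM

namespace TwoValuedInstance

variable (I : TwoValuedInstance)

/-- Common core of both parts of the theorem: they differ only in the prelude `Q` that supplies `k`,
and in the prefix `pre` that precedes the instance. -/
theorem exists_finds {α : ℝ} (hα : 1 < α) (hI : I.Feasible) {k : ℕ} (hk : IsBestRounding α k)
    {Q : RAM.Cmd} (hQ : Q.loopFree = true) (hQ' : Q.storeFree = true) {pre : List ℕ}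
    (h8 : (Q.eval (RAM.init (pre ++ I.encode))).reg 8 = 0)
    (h2 : (Q.eval (RAM.init (pre ++ I.encode))).reg 2 = k)
    (h18 : (Q.eval (RAM.init (pre ++ I.encode))).reg 18 = pre.length) :
    ∃ S : I.Schedule, I.Finds (.seq (.seq Q .setup) .schedule) (pre ++ I.encode) S
      ((RAM.timeBound (RAM.Cmd.seq Q .setup).len).eval (RAM.bitLength (pre ++ I.encode))) ∧
      I.makespan α S ≤ approxRatio α * I.opt α := by
  have hk0 : 0 < k := by
    rcases hk with ⟨rfl, -⟩ | ⟨rfl, -⟩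
    · exact Nat.floor_pos.2 hα.le
    · exact Nat.ceil_pos.2 (by linarith)
  set w := pre ++ I.encode with hw
  have hwi : ∀ i, w.getD (pre.length + i) 0 = I.encode.getD i 0 :=
    RAM.getD_append_length_add _ _
  have hlen : w.length = pre.length + 2 + I.numJobs + I.numJobs * I.numMachines := by
    rw [hw, List.length_append, length_encode]
    ring
  have hL := RAM.length_le_bitLength w
  obtain ⟨τ⟩ : Nonempty I.Schedule := by
    choose f hf using hI
    exact ⟨f, hf⟩
  obtain ⟨_, hQe, -⟩ := RAM.exec_eval hQ (by omega) (RAM.bounded_init w)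
  have hmem := hQe.mem_eq hQ'
  obtain ⟨t, ht1, ht2, ht3⟩ := RAM.exec_eval (P := .seq Q .setup) (by simp [RAM.Cmd.loopFree, hQ,
    RAM.Cmd.setup]) (by omega) (RAM.bounded_init w)
  have hinv := RAM.eval_setup (p := I.roundedSize (min k (I.numJobs + 1))) (A := I.Adm) h8 hmem
    h18 h2 (by simpa [RAM.init] using (hwi 0).trans I.getD_encode_zero)
    (by simpa [RAM.init] using (hwi 1).trans I.getD_encode_one)
    (fun i hi => List.getD_eq_default _ _ (by omega))
  obtain ⟨s', σ, d, C, ⟨t', h3, h4⟩, h5, h6, h7⟩ := RAM.exists_runs_schedule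
    (I.isInput hwi (by omega)) rfl (I.isSchedule_toIndices τ) (Nat.min_le_right _ _) hinv
    (L := RAM.bitLength w) (by omega) (fun h0 => by
      -- With at least one job the matrix has at least `m` entries, so `m` is bounded by the input
      -- length.
      have := Nat.le_mul_of_pos_left I.numMachines (Nat.pos_of_ne_zero h0)
      omega)
  have hadm : ∀ j : Fin I.numJobs, ∃ i : Fin I.numMachines,
      σ j = i + 1 ∧ I.allowed j i = true := fun j => by
    obtain ⟨hj, hv, h⟩ := h5.adm j j.2 (h6 j j.2)
    have := h6 j j.2
    exact ⟨⟨σ j - 1, hv⟩, by simp; omega, h⟩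
  choose S hS1 hS2 using hadm
  refine ⟨⟨S, hS2⟩, ⟨s', _, ht1.seq h3, ?_, fun j => ?_⟩, I.makespan_le_of_inv hα hk ⟨S, hS2⟩ hS1 h5⟩
  · have h8 := (h4 _ ht3).1
    simp [RAM.timeBound]
    exact Nat.add_le_add ht2 h8
  · rw [h7 j j.2, hS1 j, Nat.add_sub_cancel]

end TwoValuedInstance

/-! ### Choice of the rounding for a rational `α` -/

theorem ceil_natCast_div (n d : ℕ) (hd : 0 < d) : ⌈(n : ℝ) / d⌉₊ = (n + d - 1) / d := by
  refine eq_of_forall_ge_iff fun x => ?_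
  rw [Nat.ceil_le, div_le_iff₀ (by exact_mod_cast hd), ← Nat.lt_succ_iff,
    Nat.div_lt_iff_lt_mul hd, Nat.succ_mul]
  norm_cast
  omega

/-- Over the common denominator `n * d * ⌊n / d⌋` the difference of the two bounds has an integer
numerator, whose sign is decided by a truncated subtraction. -/
theorem isBestRounding_natCast_div {n d : ℕ} (hd : 0 < d) (hnd : d < n) :
    IsBestRounding ((n : ℝ) / d)
      (if ((n + d - 1) / d - 1) * d * d * (n / d) - n * (n - d) = 0 then (n + d - 1) / d
        else n / d) := by
  have hd' : (0 : ℝ) < d := by exact_mod_cast hd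
  have hn' : (0 : ℝ) < n := by exact_mod_cast hd.trans hnd
  have hα : (0 : ℝ) ≤ (n : ℝ) / d := by positivity
  have hf : 0 < n / d := Nat.div_pos hnd.le hd
  have hc : 0 < (n + d - 1) / d := Nat.div_pos (by omega) hd
  have hf' : (0 : ℝ) < ((n / d : ℕ) : ℝ) := by exact_mod_cast hf
  have e1 : ((⌊(n : ℝ) / d⌋ : ℤ) : ℝ) = ((n / d : ℕ) : ℝ) := by
    rw [← natCast_floor_eq_intCast_floor hα, Nat.floor_div_eq_div]
  have e2 : ((⌈(n : ℝ) / d⌉ : ℤ) : ℝ) = (((n + d - 1) / d : ℕ) : ℝ) := by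
    rw [← natCast_ceil_eq_intCast_ceil hα, ceil_natCast_div _ _ hd]
  set f := n / d
  set c := (n + d - 1) / d
  have key : (1 / f₂ ((n : ℝ) / d) + 1 - 1 / (⌊(n : ℝ) / d⌋ : ℝ)) -
      (1 + f₁ ((n : ℝ) / d) - 1 / ((n : ℝ) / d)) =
      (n * (n - d) - (c - 1) * d * d * f) / (n * d * f) := by
    rw [f₁, f₂, e1, e2]
    field_simp
    ring
  have hcast : ((((c - 1) * d * d * f : ℕ) : ℝ) ≤ ((n * (n - d) : ℕ) : ℝ)) ↔
      ((c : ℝ) - 1) * d * d * f ≤ n * (n - d) := by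
    rw [Nat.cast_mul, Nat.cast_mul, Nat.cast_mul, Nat.cast_sub hc, Nat.cast_mul,
      Nat.cast_sub hnd.le, Nat.cast_one]
  rw [Nat.cast_le] at hcast
  have hpos : (0 : ℝ) < n * d * f := by positivity
  split_ifs with h
  · refine Or.inr ⟨(ceil_natCast_div _ _ hd).symm, min_eq_left (sub_nonneg.1 ?_)⟩
    rw [key]
    exact div_nonneg (sub_nonneg.2 (hcast.1 (Nat.sub_eq_zero_iff_le.1 h))) hpos.le
  · refine Or.inl ⟨(Nat.floor_div_eq_div _ _).symm, min_eq_right (sub_nonpos.1 ?_)⟩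
    rw [key]
    have h1 : ¬ ((c : ℝ) - 1) * d * d * f ≤ n * (n - d) := fun h1 =>
      h (Nat.sub_eq_zero_iff_le.2 (hcast.2 h1))
    exact div_nonpos_of_nonpos_of_nonneg (by linarith) hpos.le

theorem RAM.eval_chooseRounding (w : List ℕ) :
    let n := w.getD 0 0
    let d := w.getD 1 0
    (Cmd.chooseRounding.eval (init w)).reg 2 =
      if ((n + d - 1) / d - 1) * d * d * (n / d) - n * (n - d) = 0 then (n + d - 1) / d
        else n / d := by
  intro n d
  simp [Cmd.chooseRounding, Cmd.eval, State.setReg, init, n, d]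
  split_ifs <;> simp

/-- Approximation of two-valued makespan minimization with assignment constraints, job sizes
`1` and `1 / α`. First part: one polynomial-time algorithm that receives a rational `α > 1` in
binary along with the instance. Second part: every real `α > 1`, fixed in advance. -/
theorem mainTheorem4 :
    (∃ (P : RAM.Cmd) (p : Polynomial ℕ), ∀ α : ℚ, 1 < α →
      ∀ I : TwoValuedInstance, I.Feasible → ∃ σ : I.Schedule,
        I.Finds P (I.encodeWith α) σ (p.eval (RAM.bitLength (I.encodeWith α))) ∧
        I.makespan (α : ℝ) σ ≤ approxRatio (α : ℝ) * I.opt (α : ℝ)) ∧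
    (∀ α : ℝ, 1 < α → ∃ (P : RAM.Cmd) (p : Polynomial ℕ),
      ∀ I : TwoValuedInstance, I.Feasible → ∃ σ : I.Schedule,
        I.Finds P I.encode σ (p.eval (RAM.bitLength I.encode)) ∧
        I.makespan α σ ≤ approxRatio α * I.opt α) := by
  constructor
  · refine ⟨.seq (.seq .chooseRounding .setup) .schedule,
      RAM.timeBound (RAM.Cmd.seq .chooseRounding .setup).len, fun α hα I hI => ?_⟩
    have hnum : ((α.num.toNat : ℕ) : ℤ) = α.num :=
      Int.toNat_of_nonneg (Rat.num_nonneg.2 (by linarith))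
    have hcast : ((α : ℚ) : ℝ) = (α.num.toNat : ℝ) / (α.den : ℝ) := by
      rw [Rat.cast_def, ← Int.cast_natCast (R := ℝ) α.num.toNat, hnum]
    have hαR : (1 : ℝ) < α := by exact_mod_cast hα
    have hd := α.den_pos
    have hnd : α.den < α.num.toNat := by
      rw [hcast, one_lt_div (by exact_mod_cast hd)] at hαR
      exact_mod_cast hαR
    have hk := isBestRounding_natCast_div hd hnd
    rw [← hcast] at hk
    refine I.exists_finds hαR hI hk (Q := .chooseRounding) (pre := [α.num.toNat, α.den]) rfl rfl
      ?_ (RAM.eval_chooseRounding _) ?_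
    · simp [RAM.Cmd.chooseRounding, RAM.Cmd.eval, RAM.State.setReg, RAM.init]
      split_ifs <;> rfl
    · simp [RAM.Cmd.chooseRounding, RAM.Cmd.eval, RAM.State.setReg, RAM.init]
      split_ifs <;> rfl
  · intro α hα
    -- For fixed `α` the program depends only on the integer `k`, a constant in its text, so `α`
    -- need not be computable.
    obtain ⟨k, hk⟩ := exists_isBestRounding α
    refine ⟨.seq (.seq (.seq (.const 2 k) (.const 18 0)) .setup) .schedule,
      RAM.timeBound (RAM.Cmd.seq (.seq (.const 2 k) (.const 18 0)) .setup).len,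
      fun I hI => I.exists_finds hα hI hk (Q := .seq (.const 2 k) (.const 18 0))
      (pre := []) rfl rfl ?_ ?_ ?_⟩ <;>
    simp [RAM.Cmd.eval, RAM.State.setReg, RAM.init]
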